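/- Let $[n]=\{1,\dots,n\}$ and let $\binom{[n]}{k}$ be the collection of all $k$-subsets of $[n]$. For a family $\mathcal F\subset 2^{[n]}$ not containing the empty set, the covering number $\tau(\mathcal F)$ is the minimum size of a set $T\subset[n]$ that meets every member of $\mathcal F$. Families $\mathcal F,\mathcal G$ are cross-intersecting if $F\cap G\neq\emptyset$ for all $F\in\mathcal F$, $G\in\mathcal G$. Two families on $[n]$ are isomorphic if a permutation of $[n]$ carries one to the other. For $s\ge 1$, let $D_1,\dots,D_{t-1}\in\binom{[n]}{b}$ be pairwise disjoint and disjoint from $[1,s]=\{1,\dots,s\}$, and put $\mathcal B'=\{B\in\binom{[n]}{b}:[1,s]\subset B\}\cup\{D_1,\dots,D_{t-1}\}$. Define (uniquely up to isomorphism) $$\mathcal M_s^t(n,a,b)=\Big\{A\in\tbinom{[n]}{a}: A\cap B\ne\emptyset\text{ for all }B\in\mathcal B'\Big\}\cup\mathcal B'.$$ **Theorem.** Let $\mathcal F\subset\binom{[n]}{a}$ and $\mathcal G\subset\binom{[n]}{b}$ be cross-intersecting families with $t\ge 2$, $b\ge 2$, $a\ge b+t-1$ and $n\ge\max\{a+b,bt\}$.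 Suppose that (1) $\tau(\mathcal F)=s$ and $\tau(\mathcal G)\ge t$, or (2) $\tau(\mathcal F)=s$ and $\tau(\mathcal G)=t$. Then $$|\mathcal F|+|\mathcal G|\le\sum_{i=1}^{s}\left(\binom{n-i}{a-1}+\sum_{j=1}^{t-1}(-1)^j\binom{t-1}{j}\binom{n-jb-i}{a-1}\right)+\binom{n-s}{b-s}+t-1.$$ Moreover, let $n>a+b$ and $s\ge1$. If $\mathcal F\cup\mathcal G$ is isomorphic to $\mathcal M_s^t(n,a,b)$, then equality holds. Conversely, if equality holds, then $\mathcal F\cup\mathcal G$ is isomorphic to $\mathcal M_s^t(n,a,b)$, unless $s=1$, $t=2$, $a=b+1$ and, in addition, $b=2$ or $\tau(\mathcal G)>2$. -/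

import Mathlib

/-- Two families of subsets of `[n]` are cross-intersecting if every member of the first meets
every member of the second. -/
def CrossIntersecting {n : ℕ} (F G : Finset (Finset (Fin n))) : Prop :=
  ∀ A ∈ F, ∀ B ∈ G, (A ∩ B).Nonempty

/-- `T` is a cover (transversal) of the family `F`. -/
def IsCover {n : ℕ} (F : Finset (Finset (Fin n))) (T : Finset (Fin n)) : Prop :=
  ∀ A ∈ F, (T ∩ A).Nonempty

/-- The covering number: the minimum size of a cover. (The minimum is over a nonempty set as soon
as the family does not contain the empty set, since then the whole ground set is a cover.) -/
noncomputable def coveringNumber {n : ℕ} (F : Finset (Finset (Fin n))) : ℕ :=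
  sInf {k : ℕ | ∃ T : Finset (Fin n), T.card = k ∧ IsCover F T}

/-- The initial segment `[1, s]` of the ground set (the first `s` elements of `Fin n`). -/
def initSegment (n s : ℕ) : Finset (Fin n) :=
  Finset.univ.filter fun i => i.val < s

/-- The family of all `b`-sets that contain `[1, s]`, together with the sets `D i`. -/
def baseFamily (n b s : ℕ) {m : ℕ} (D : Fin m → Finset (Fin n)) : Finset (Finset (Fin n)) :=
  ((Finset.powersetCard b Finset.univ).filter fun B => initSegment n s ⊆ B) ∪
    Finset.univ.image D

/-- All `a`-sets that meet every member of the base family, together with the base family. -/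
def extremalFamily (n a b s : ℕ) {m : ℕ} (D : Fin m → Finset (Fin n)) :
    Finset (Finset (Fin n)) :=
  ((Finset.powersetCard a Finset.univ).filter fun A => ∀ B ∈ baseFamily n b s D, (A ∩ B).Nonempty) ∪
    baseFamily n b s D

/-- `M` is a family `M_s^t(n, a, b)`, for some choice of `t - 1` pairwise disjoint `b`-sets that
are disjoint from `[1, s]`. -/
def IsExtremalFamily (n a b s t : ℕ) (M : Finset (Finset (Fin n))) : Prop :=
  ∃ D : Fin (t - 1) → Finset (Fin n),
    (∀ i, (D i).card = b) ∧
    (∀ i, Disjoint (D i) (initSegment n s)) ∧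
    (∀ i j, i ≠ j → Disjoint (D i) (D j)) ∧
    M = extremalFamily n a b s D

/-- Two families on `[n]` are isomorphic if a permutation of `[n]` carries one to the other. -/
def FamilyIso {n : ℕ} (H K : Finset (Finset (Fin n))) : Prop :=
  ∃ σ : Equiv.Perm (Fin n), H.image (fun A => A.image σ) = K

/-- The bound `∑_{i=1}^s (C(n-i,a-1) + ∑_{j=1}^{t-1} (-1)^j C(t-1,j) C(n-jb-i,a-1)) + C(n-s,b-s)
+ t - 1`, as an integer. -/
def crossBound (n a b s t : ℕ) : ℤ :=
  (∑ i ∈ Finset.Icc 1 s,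
      (((n - i).choose (a - 1) : ℤ) +
        ∑ j ∈ Finset.Icc 1 (t - 1),
          (-1 : ℤ) ^ j * ((t - 1).choose j : ℤ) * ((n - j * b - i).choose (a - 1) : ℤ))) +
    ((n - s).choose (b - s) : ℤ) + (t : ℤ) - 1

/-! ### Binomial inequalities. -/

namespace CrossCover
open Finset

theorem choose_lt_choose_succ {n k : ℕ} (h : 2 * k + 1 < n) : n.choose k < n.choose (k + 1) := by
  have h1 := Nat.choose_succ_right_eq n k
  have h2 : 0 < n.choose k := Nat.choose_pos (by omega)
  have h3 : n.choose k * (k + 1) < n.choose k * (n - k) :=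
    Nat.mul_lt_mul_of_pos_left (by omega) h2
  rw [← h1] at h3
  exact Nat.lt_of_mul_lt_mul_right h3

theorem choose_lt_choose {n k a : ℕ} (h : k < a) (hn : a + k < n) :
    n.choose k < n.choose a := by
  obtain ⟨d, rfl⟩ := Nat.exists_eq_add_of_lt h
  induction d generalizing k with
  | zero => exact choose_lt_choose_succ (by omega)
  | succ d ih =>
    have h1 : n.choose k < n.choose (k + 1) := choose_lt_choose_succ (by omega)
    rcases Nat.lt_or_ge (k + (d + 1) + 1 + (k + 1)) n with h2 | h2
    · have := ih (k := k + 1) (by omega) (by omega)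
      rw [show k + 1 + d + 1 = k + (d + 1) + 1 by omega] at this
      omega
    · rwa [← Nat.choose_symm_of_eq_add (n := n) (a := k + 1) (b := k + (d + 1) + 1) (by omega)]

theorem choose_le_choose_of_add_le {n k a : ℕ} (h : k ≤ a) (hn : a + k ≤ n) :
    n.choose k ≤ n.choose a := by
  rcases h.eq_or_lt with rfl | h
  · rfl
  rcases hn.eq_or_lt with h1 | h1
  · rw [Nat.choose_symm_of_eq_add (n := n) (a := k) (b := a) (by omega)]
  · exact (choose_lt_choose h h1).le

/-- Classify the `a`-subsets meeting a `j`-set by the first element of the `j`-set they contain. -/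
theorem sum_choose_add_choose (a j n : ℕ) (ha : 1 ≤ a) (hj : j ≤ n) :
    ∑ i ∈ range j, (n - 1 - i).choose (a - 1) + (n - j).choose a = n.choose a := by
  induction j with
  | zero => simp
  | succ j ih =>
    obtain ⟨a, rfl⟩ := Nat.exists_eq_add_of_le' ha
    have h := Nat.choose_succ_succ' (n - 1 - j) a
    rw [show n - 1 - j + 1 = n - j by omega] at h
    have h' := ih (by omega)
    rw [sum_range_succ, show n - (j + 1) = n - 1 - j by omega]
    rw [Nat.add_sub_cancel] at h' ⊢
    omega

/-- Classify the `k`-subsets by the first element they miss. -/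
theorem sum_choose_diag_add_one (k n : ℕ) (hk : k ≤ n) :
    ∑ i ∈ range k, (n - 1 - i).choose (k - i) + 1 = n.choose k := by
  induction k generalizing n with
  | zero => simp
  | succ k ih =>
    obtain ⟨n, rfl⟩ := Nat.exists_eq_add_of_le' (show 1 ≤ n by omega)
    rw [sum_range_succ', Nat.choose_succ_succ', ← ih n (by omega)]
    have : ∀ i, n + 1 - 1 - (i + 1) = n - 1 - i := fun i => by omega
    simp only [this, Nat.add_sub_add_right]
    simp only [Nat.add_sub_cancel, Nat.sub_zero]
    omega

/-! ### Numbers of sets meeting disjoint blocks. -/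

/-- The number of `a`-subsets of an `n`-set that meet each of `t` pairwise disjoint `b`-subsets. -/
def meetCount (b : ℕ) : ℕ → ℕ → ℕ → ℕ
  | 0, n, a => n.choose a
  | t + 1, n, a => ∑ i ∈ range b, meetCount b t (n - 1 - i) (a - 1)

/-- The number of `a`-subsets of an `n`-set that meet each of `t` pairwise disjoint `b`-subsets and
a further disjoint `j`-subset. -/
def meetCountWith (b t j n a : ℕ) : ℕ := ∑ i ∈ range j, meetCount b t (n - 1 - i) (a - 1)

theorem meetCount_succ (b t n a : ℕ) : meetCount b (t + 1) n a = meetCountWith b t b n a := rfl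

@[simp] theorem meetCount_zero (b n a : ℕ) : meetCount b 0 n a = n.choose a := rfl

@[simp] theorem meetCountWith_zero (b t n a : ℕ) : meetCountWith b t 0 n a = 0 := rfl

theorem meetCountWith_succ (b t j n a : ℕ) : meetCountWith b t (j + 1) n a =
    meetCount b t (n - 1) (a - 1) + meetCountWith b t j (n - 1) a := by
  unfold meetCountWith
  rw [sum_range_succ', add_comm]
  congr 1
  refine sum_congr rfl fun i _ => ?_
  congr 1
  omega

theorem meetCountWith_mono (b t n a : ℕ) {j k : ℕ} (h : j ≤ k) :
    meetCountWith b t j n a ≤ meetCountWith b t k n a :=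
  sum_le_sum_of_subset (range_subset_range.2 h)

/-- Compare `sum_choose_diag_add_one` term by term with the first k+1 of the b summands of
`meetCount`; the extra 1 is matched with the summand i = k. -/
theorem choose_le_meetCount {b t n a k : ℕ} (hk : k < b) (ha : b + t ≤ a + 1) (hn : a + k ≤ n) :
    n.choose k ≤ meetCount b t n a := by
  induction t generalizing n a k with
  | zero => exact choose_le_choose_of_add_le (by omega) hn
  | succ t ih =>
    rw [meetCount_succ]
    refine le_trans ?_ (meetCountWith_mono b t n a (show k + 1 ≤ b from hk))
    rw [← sum_choose_diag_add_one k n (by omega), meetCountWith, sum_range_succ]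
    refine add_le_add (sum_le_sum fun i hi => ?_) ?_
    · rw [mem_range] at hi
      exact ih (by omega) (by omega) (by omega)
    · simpa using ih (n := n - 1 - k) (a := a - 1) (k := 0) (by omega) (by omega) (by omega)

theorem choose_lt_meetCount {b t n a k : ℕ} (hk : k < b) (hb : 2 ≤ b) (ht : 1 ≤ t)
    (ha : b + t ≤ a + 1) (hn : a + k < n) : n.choose k < meetCount b t n a := by
  obtain ⟨t, rfl⟩ := Nat.exists_eq_add_of_le' ht
  rw [meetCount_succ]
  refine lt_of_lt_of_le ?_ (meetCountWith_mono b t n a (show k + 1 ≤ b from hk))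
  rw [← sum_choose_diag_add_one k n (by omega), meetCountWith, sum_range_succ]
  refine add_lt_add_of_le_of_lt (sum_le_sum fun i hi => ?_) ?_
  · rw [mem_range] at hi
    exact choose_le_meetCount (by omega) (by omega) (by omega)
  · have := choose_le_meetCount (b := b) (t := t) (n := n - 1 - k) (a := a - 1) (k := 1)
      (by omega) (by omega) (by omega)
    rw [Nat.choose_one_right] at this
    omega

theorem choose_le_meetCountWith_add_one {b t n a k : ℕ} (hk : k < b) (ha : b + t ≤ a)
    (hn : a + k ≤ n) : n.choose k ≤ meetCountWith b t k n a + 1 := by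
  rw [← sum_choose_diag_add_one k n (by omega), meetCountWith]
  refine add_le_add_left (sum_le_sum fun i hi => ?_) 1
  rw [mem_range] at hi
  exact choose_le_meetCount (by omega) (by omega) (by omega)

/-- Strict version of `choose_le_meetCountWith_add_one`. -/
theorem choose_lt_meetCountWith_add_one {b t n a k : ℕ} (hk : k < b) (hk1 : 1 ≤ k)
    (ha : b + t ≤ a) (hn : a + k < n) (h : 1 ≤ t ∨ k + 1 < a ∨ 2 ≤ k) :
    n.choose k < meetCountWith b t k n a + 1 := by
  rw [← sum_choose_diag_add_one k n (by omega), meetCountWith]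
  refine add_lt_add_left ?_ 1
  refine sum_lt_sum (fun i hi => ?_) ?_
  · rw [mem_range] at hi
    exact choose_le_meetCount (by omega) (by omega) (by omega)
  -- For t = 0 the summands are C(n-1-i, k-i) and C(n-1-i, a-1). The first pair is strict unless a =
  -- k+1, and then the second is strict if k ≥ 2. The case left out, k = 1 and a = b = 2, gives
  -- equality; this is where b = 2 becomes exceptional.
  · rcases Nat.eq_zero_or_pos t with rfl | ht
    · rcases h with h | h | h
      · omega
      · exact ⟨0, mem_range.2 (by omega), choose_lt_choose (by omega) (by omega)⟩
      · exact ⟨1, mem_range.2 (by omega), choose_lt_choose (by omega) (by omega)⟩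
    · exact ⟨0, mem_range.2 (by omega),
        choose_lt_meetCount (by omega) (by omega) ht (by omega) (by omega)⟩

/-- When n < a + b no a-set can miss a b-set, so the meeting conditions cost nothing. This covers
the range outside the slice bound. -/
theorem choose_le_meetCount_of_lt {b t n a : ℕ} (h : n < a + b) :
    n.choose a ≤ meetCount b t n a := by
  induction t generalizing n a with
  | zero => rfl
  | succ t ih =>
    rw [meetCount_succ, meetCountWith]
    refine le_trans ?_ (sum_le_sum fun i hi => ih (n := n - 1 - i) (a := a - 1) ?_)
    · rcases Nat.eq_zero_or_pos a with rfl | ha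
      · simp; omega
      · rcases Nat.lt_or_ge n b with hb | hb
        · rw [← sum_choose_add_choose a n n ha le_rfl, Nat.sub_self, Nat.choose_eq_zero_of_lt ha]
          exact sum_le_sum_of_subset (range_subset_range.2 hb.le)
        · rw [← sum_choose_add_choose a b n ha hb, Nat.choose_eq_zero_of_lt (by omega)]
          rfl
    · rw [mem_range] at hi
      omega

/-- Passing from a `j`-set to a larger `b`-set strictly increases the count. -/
theorem meetCountWith_add_le_meetCount_succ {b t j n a : ℕ} (hj : j < b) :
    meetCountWith b t j n a + meetCount b t (n - 1 - j) (a - 1) ≤ meetCount b (t + 1) n a := by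
  rw [meetCount_succ, meetCountWith, ← sum_range_succ]
  exact meetCountWith_mono b t n a (show j + 1 ≤ b from hj)

end CrossCover
-- Cross-intersecting families without covering conditions.
namespace CrossCover
open Finset
variable {α : Type*} [DecidableEq α]

/-- Cross-intersecting uniform families have total size at most that of a full layer. -/
theorem card_add_card_le_choose {V : Finset α} {a j : ℕ} {F G : Finset (Finset α)}
    (hF : F ⊆ powersetCard a V) (hG : G ⊆ powersetCard j V)
    (hFG : ∀ A ∈ F, ∀ B ∈ G, (A ∩ B).Nonempty) (hj : j ≤ a) (hn : a + j ≤ #V) :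
    #F + #G ≤ (#V).choose a := by
  -- Double count the disjoint pairs (B, A) with B in G: every a-set disjoint from B lies outside F.
  have key : #G * (#V - j).choose a ≤ #(powersetCard a V \ F) * (#V - a).choose j := by
    refine card_mul_le_card_mul (fun B A => Disjoint B A) (fun B hB => ?_) (fun A hA => ?_)
    · have hB' := mem_powersetCard.1 (hG hB)
      rw [← hB'.2, ← card_sdiff_of_subset hB'.1, ← card_powersetCard]
      refine card_le_card fun A hA => ?_
      rw [mem_powersetCard, subset_sdiff] at hA
      rw [mem_bipartiteAbove, mem_sdiff, mem_powersetCard]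
      refine ⟨⟨⟨hA.1.1, hA.2⟩, fun h => ?_⟩, hA.1.2.symm⟩
      exact not_disjoint_iff_nonempty_inter.2 (hFG A h B hB) hA.1.2
    · have hA' := mem_powersetCard.1 (mem_sdiff.1 hA).1
      rw [← hA'.2, ← card_sdiff_of_subset hA'.1, ← card_powersetCard]
      refine card_le_card fun B hB => ?_
      rw [mem_bipartiteBelow] at hB
      have hB' := mem_powersetCard.1 (hG hB.1)
      rw [mem_powersetCard, subset_sdiff]
      exact ⟨⟨hB'.1, hB.2⟩, hB'.2⟩
  have h1 : (#V).choose (a + j) * (a + j).choose a = _ := Nat.choose_mul (by omega)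
  have h2 : (#V).choose (a + j) * (a + j).choose j = _ := Nat.choose_mul (by omega)
  rw [Nat.add_sub_cancel_left] at h1
  rw [Nat.add_sub_cancel, ← Nat.choose_symm_add, h1] at h2
  have h3 : (#V - a).choose j ≤ (#V - j).choose a := by
    have h4 := choose_le_choose_of_add_le hj hn
    have h5 : (#V).choose a * (#V - a).choose j ≤ (#V).choose a * (#V - j).choose a := by
      rw [h2]
      exact Nat.mul_le_mul_right _ h4
    exact Nat.le_of_mul_le_mul_left h5 (Nat.choose_pos (by omega))
  have h6 : #G ≤ #(powersetCard a V \ F) := by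
    have h7 : 0 < (#V - j).choose a := Nat.choose_pos (by omega)
    exact Nat.le_of_mul_le_mul_right (key.trans (Nat.mul_le_mul_left _ h3)) h7
  rw [card_sdiff_of_subset hF, card_powersetCard] at h6
  have := card_le_card hF
  rw [card_powersetCard] at this
  omega

theorem mem_powersetCard_insert {V A : Finset α} {a : ℕ} {x : α} (ha : 1 ≤ a) (hx : x ∈ V)
    (hxA : x ∉ A) : insert x A ∈ powersetCard a V ↔ A ∈ powersetCard (a - 1) (V.erase x) := by
  rw [mem_powersetCard, mem_powersetCard, card_insert_of_notMem hxA, insert_subset_iff,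
    subset_erase]
  constructor
  · rintro ⟨h1, h2⟩
    exact ⟨⟨h1.2, hxA⟩, by omega⟩
  · rintro ⟨h1, h2⟩
    exact ⟨⟨hx, h1.1⟩, by omega⟩

theorem insert_inter_nonempty {A D : Finset α} {x : α} (hx : x ∉ D) :
    (insert x A ∩ D).Nonempty ↔ (A ∩ D).Nonempty := by
  rw [insert_inter_of_notMem hx]

/-- The count `meetCountWith` is attained, given that `meetCount` is. -/
theorem card_filter_meet_with_aux {b t : ℕ}
    (h : ∀ (V : Finset α) (a : ℕ) (𝒟 : Finset (Finset α)), #𝒟 = t → t ≤ a →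
      (∀ D ∈ 𝒟, #D = b ∧ D ⊆ V) → (𝒟 : Set (Finset α)).PairwiseDisjoint id →
      #{A ∈ powersetCard a V | ∀ D ∈ 𝒟, (A ∩ D).Nonempty} = meetCount b t #V a)
    (a : ℕ) (𝒟 : Finset (Finset α)) (ht : #𝒟 = t) (ha : t + 1 ≤ a)
    (hpd : (𝒟 : Set (Finset α)).PairwiseDisjoint id) (K V : Finset α) (hK : K ⊆ V)
    (hD : ∀ D ∈ 𝒟, #D = b ∧ D ⊆ V) (hKD : ∀ D ∈ 𝒟, Disjoint D K) :
    #{A ∈ powersetCard a V | (A ∩ K).Nonempty ∧ ∀ D ∈ 𝒟, (A ∩ D).Nonempty} =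
      meetCountWith b t #K #V a := by
  induction K using Finset.induction_on generalizing V with
  | empty => simp
  | insert x K hxK ih =>
    have hxV : x ∈ V := hK (mem_insert_self _ _)
    have hxD : ∀ D ∈ 𝒟, x ∉ D := fun D h h' =>
      disjoint_left.1 (hKD D h) h' (mem_insert_self _ _)
    have hD' : ∀ D ∈ 𝒟, #D = b ∧ D ⊆ V.erase x := fun D h =>
      ⟨(hD D h).1, subset_erase.2 ⟨(hD D h).2, hxD D h⟩⟩
    have h1 := h (V.erase x) (a - 1) 𝒟 ht (by omega) hD' hpd
    have h2 := ih (V.erase x) (subset_erase.2 ⟨(insert_subset_iff.1 hK).2, hxK⟩) hD'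
      fun D h => (hKD D h).mono_right (subset_insert _ _)
    rw [card_insert_of_notMem hxK, meetCountWith_succ, ← card_erase_of_mem hxV, ← h1, ← h2,
      -- A set through x already meets the extra block and only has to meet the D's; a set avoiding
      -- x has to meet the block without x.
      ← card_memberSubfamily_add_card_nonMemberSubfamily x]
    congr 2
    · ext A
      rw [mem_memberSubfamily]
      constructor
      · rintro ⟨hA, hxA⟩
        rw [mem_filter, mem_powersetCard_insert (by omega) hxV hxA] at hA
        exact mem_filter.2 ⟨hA.1, fun D hD => (insert_inter_nonempty (hxD D hD)).1 (hA.2.2 D hD)⟩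
      · intro hA
        rw [mem_filter] at hA
        have hxA : x ∉ A := fun hx => notMem_erase x V ((mem_powersetCard.1 hA.1).1 hx)
        rw [mem_filter, mem_powersetCard_insert (by omega) hxV hxA]
        exact ⟨⟨hA.1, ⟨x, by simp⟩, fun D hD => (insert_inter_nonempty (hxD D hD)).2 (hA.2 D hD)⟩,
          hxA⟩
    · ext A
      simp only [mem_nonMemberSubfamily, mem_filter, mem_powersetCard, subset_erase]
      constructor
      · rintro ⟨⟨⟨h1, h2⟩, h3, h4⟩, h5⟩
        rw [inter_insert_of_notMem h5] at h3
        exact ⟨⟨⟨h1, h5⟩, h2⟩, h3, h4⟩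
      · rintro ⟨⟨⟨h1, h5⟩, h2⟩, h3, h4⟩
        rw [inter_insert_of_notMem h5]
        exact ⟨⟨⟨h1, h2⟩, h3, h4⟩, h5⟩

/-- The condition t ≤ a matters: because a - 1 is truncated, `meetCount` at a = 0 takes the value b
^ t, although the empty set meets nothing. -/
theorem card_filter_meet (b t : ℕ) (V : Finset α) (a : ℕ) (𝒟 : Finset (Finset α)) (ht : #𝒟 = t)
    (ha : t ≤ a) (hD : ∀ D ∈ 𝒟, #D = b ∧ D ⊆ V) (hpd : (𝒟 : Set (Finset α)).PairwiseDisjoint id) :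
    #{A ∈ powersetCard a V | ∀ D ∈ 𝒟, (A ∩ D).Nonempty} = meetCount b t #V a := by
  induction t generalizing V a 𝒟 with
  | zero =>
    rw [card_eq_zero] at ht
    subst ht
    simp
  | succ t ih =>
    obtain ⟨K, 𝒟, hK, rfl, hc⟩ := card_eq_succ.1 ht
    have hKD : ∀ D ∈ 𝒟, Disjoint D K := fun D hD =>
      hpd (mem_insert_of_mem hD) (mem_insert_self _ _) (fun h => hK (h ▸ hD))
    have h1 := card_filter_meet_with_aux (b := b) (t := t) (fun V a 𝒟 => ih V a 𝒟) a 𝒟 hc ha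
      (hpd.subset (coe_subset.2 (subset_insert _ _))) K V (hD K (mem_insert_self _ _)).2
      (fun D h => hD D (mem_insert_of_mem h)) hKD
    rw [(hD K (mem_insert_self _ _)).1] at h1
    rw [meetCount_succ, ← h1]
    congr 1
    ext A
    simp [and_assoc]

theorem card_filter_meet_with {b t a : ℕ} {𝒟 : Finset (Finset α)} (ht : #𝒟 = t) (ha : t + 1 ≤ a)
    (hpd : (𝒟 : Set (Finset α)).PairwiseDisjoint id) {K V : Finset α} (hK : K ⊆ V)
    (hD : ∀ D ∈ 𝒟, #D = b ∧ D ⊆ V) (hKD : ∀ D ∈ 𝒟, Disjoint D K) :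
    #{A ∈ powersetCard a V | (A ∩ K).Nonempty ∧ ∀ D ∈ 𝒟, (A ∩ D).Nonempty} =
      meetCountWith b t #K #V a :=
  card_filter_meet_with_aux (card_filter_meet b t) a 𝒟 ht ha hpd K V hK hD hKD

theorem card_filter_meet_one (b : ℕ) {a : ℕ} (ha : 1 ≤ a) {K V : Finset α} (hK : K ⊆ V) :
    #{A ∈ powersetCard a V | (A ∩ K).Nonempty} = meetCountWith b 0 #K #V a := by
  simpa using card_filter_meet_with (b := b) (𝒟 := (∅ : Finset (Finset α))) rfl ha (by simp) hK
    (by simp) (by simp)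

/-! ### The Hilton–Milner bound by uncrossing under transpositions. -/

section Swap
open scoped Pointwise

theorem swap_smul_eq_self {u v : α} {B : Finset α} (h : u ∈ B ↔ v ∈ B) :
    Equiv.swap u v • B = B := by
  ext w
  rw [← inv_smul_mem_iff, Equiv.swap_inv, Equiv.Perm.smul_def]
  by_cases hu : w = u
  · subst hu; simp [h]
  by_cases hv : w = v
  · subst hv; simp [h]
  rw [Equiv.swap_apply_of_ne_of_ne hu hv]

theorem swap_smul_trans {G : Finset (Finset α)} {u v z : α} (hu : Equiv.swap u z • G = G)
    (hv : Equiv.swap v z • G = G) : Equiv.swap u v • G = G := by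
  by_cases huz : u = z
  · subst huz; rwa [Equiv.swap_comm]
  by_cases huv : u = v
  · subst huv
    rw [Equiv.swap_self]
    exact one_smul (Equiv.Perm α) G
  rw [Equiv.swap_comm v z] at hv
  rw [Equiv.swap_comm u v, ← Equiv.swap_mul_swap_mul_swap huz huv, mul_smul, mul_smul, hv, hu, hv]

theorem smul_mem_powersetCard {V A : Finset α} {b : ℕ} {u v : α} (hu : u ∈ V) (hv : v ∈ V)
    (hA : A ∈ powersetCard b V) : Equiv.swap u v • A ∈ powersetCard b V := by
  rw [mem_powersetCard] at hA ⊢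
  rw [card_smul_finset]
  refine ⟨?_, hA.2⟩
  rw [← swap_smul_eq_self (B := V) (u := u) (v := v) (by simp [hu, hv])]
  exact smul_finset_subset_smul_finset hA.1

/-- A family invariant under all transpositions of points of `V` is empty as soon as it is
crossed by some set `A` that is not too large. -/
theorem not_crossing_of_swap_invariant {V A : Finset α} {b : ℕ} {G : Finset (Finset α)}
    (hA : A ⊆ V) (hAV : #A + b ≤ #V) (hG : G ⊆ powersetCard b V)
    (hAG : ∀ B ∈ G, (A ∩ B).Nonempty) (hinv : ∀ u ∈ V, ∀ v ∈ V, Equiv.swap u v • G = G) :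
    G = ∅ := by
  by_contra hne
  obtain ⟨B, hB, hmin⟩ := exists_min_image G (fun B => #(A ∩ B)) (nonempty_iff_ne_empty.2 hne)
  have hB' := mem_powersetCard.1 (hG hB)
  obtain ⟨u, hu⟩ := hAG B hB
  rw [mem_inter] at hu
  obtain ⟨v, hvV, hv⟩ : ∃ v ∈ V, v ∉ A ∪ B := by
    by_contra! h
    have h1 := card_le_card h
    have h2 := card_union_add_card_inter A B
    have h3 : 0 < #(A ∩ B) := card_pos.2 (hAG B hB)
    omega
  rw [mem_union, not_or] at hv
  have hmem : Equiv.swap u v • B ∈ G := by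
    rw [← hinv u (hA hu.1) v hvV]
    exact smul_mem_smul_finset hB
  -- Exchanging u in A ∩ B for v outside A ∪ B lowers the intersection with A, against the minimal
  -- choice of B.
  have hlt : #(A ∩ Equiv.swap u v • B) < #(A ∩ B) := by
    refine card_lt_card ⟨fun w hw => ?_, fun h => ?_⟩
    · rw [mem_inter, ← inv_smul_mem_iff, Equiv.swap_inv, Equiv.Perm.smul_def] at hw
      have h1 : w ≠ v := fun h => hv.1 (h ▸ hw.1)
      have h2 : w ≠ u := by
        rintro rfl
        rw [Equiv.swap_apply_left] at hw
        exact hv.2 hw.2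
      rw [Equiv.swap_apply_of_ne_of_ne h2 h1] at hw
      exact mem_inter.2 hw
    · have := mem_inter.1 (h (mem_inter.2 hu))
      rw [← inv_smul_mem_iff, Equiv.swap_inv, Equiv.Perm.smul_def, Equiv.swap_apply_left] at this
      exact hv.2 this.2
  exact absurd (hmin _ hmem) (not_le.2 hlt)

/-- A family of `b`-sets that is a block of imprimitivity for the transpositions, and that is
crossed by some `b`-set, has at most one member. -/
theorem card_le_one_of_block {V A : Finset α} {b : ℕ} {G : Finset (Finset α)}
    (hn : 2 * b < #V) (hA : A ∈ powersetCard b V) (hG : G ⊆ powersetCard b V)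
    (hAG : ∀ B ∈ G, (A ∩ B).Nonempty)
    (hblock : ∀ u ∈ V, ∀ v ∈ V, ∀ B ∈ G, Equiv.swap u v • B ∈ G → Equiv.swap u v • G = G) :
    #G ≤ 1 := by
  by_contra! hlt
  obtain ⟨B, hB, B', hB', hne⟩ := one_lt_card.1 hlt
  have hBV := mem_powersetCard.1 (hG hB)
  have hBV' := mem_powersetCard.1 (hG hB')
  rw [mem_powersetCard] at hA
  obtain ⟨x, hxB, hxB'⟩ : ∃ x ∈ B, x ∉ B' := by
    by_contra! h
    exact hne (eq_of_subset_of_card_le h (by omega))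
  obtain ⟨z, hzV, hz⟩ : ∃ z ∈ V, z ∉ B ∪ B' := by
    by_contra! h
    have h1 := card_le_card h
    have h2 := card_union_le B B'
    omega
  rw [mem_union, not_or] at hz
  have hfix : ∀ u ∈ V, ∀ v ∈ V, ∀ B ∈ G, (u ∈ B ↔ v ∈ B) → Equiv.swap u v • G = G :=
    fun u hu v hv B hB h => hblock u hu v hv B hB ((swap_smul_eq_self h).symm ▸ hB)
  have hxz : Equiv.swap x z • G = G :=
    hfix x (hBV.1 hxB) z hzV B' hB' (by simp [hxB', hz.2])
  have hB2 : Equiv.swap x z • B ∈ G := by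
    have := smul_mem_smul_finset (a := Equiv.swap x z) hB
    rwa [hxz] at this
  -- The transposition (u z) fixes B if u is outside B, and fixes the image of B under (x z) if u ≠
  -- x lies in B. Both sets belong to G, so the block property applies.
  have hall : ∀ u ∈ V, Equiv.swap u z • G = G := by
    intro u hu
    by_cases huB : u ∈ B
    · by_cases hux : u = x
      · rwa [hux]
      · have huz : u ≠ z := by
          rintro rfl
          exact hz.1 huB
        refine hfix u hu z hzV _ hB2 ?_
        rw [← inv_smul_mem_iff, ← inv_smul_mem_iff, Equiv.swap_inv, Equiv.Perm.smul_def,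
          Equiv.Perm.smul_def, Equiv.swap_apply_right,
          Equiv.swap_apply_of_ne_of_ne hux huz]
        simp [huB, hxB]
    · exact hfix u hu z hzV B hB (by simp [huB, hz.1])
  have := not_crossing_of_swap_invariant hA.1 (by omega) hG hAG
    fun u hu v hv => swap_smul_trans (hall u hu) (hall v hv)
  rw [this] at hlt
  simp at hlt

/-- The Hilton–Milner bound for two nonempty cross-intersecting families of `b`-sets. -/
theorem card_add_card_le_of_nonempty {V : Finset α} {b : ℕ} {F G : Finset (Finset α)}
    (hb : 1 ≤ b) (hn : 2 * b ≤ #V) (hF : F ⊆ powersetCard b V) (hG : G ⊆ powersetCard b V)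
    (hFG : ∀ A ∈ F, ∀ B ∈ G, (A ∩ B).Nonempty) (hF0 : F.Nonempty) (hG0 : G.Nonempty) :
    #F + #G ≤ meetCountWith b 0 b #V b + 1 := by
  rcases hn.eq_or_lt with hn | hn
  · have h1 := card_add_card_le_choose hF hG hFG le_rfl (by omega)
    have h2 := sum_choose_add_choose b b #V hb (by omega)
    rw [show #V - b = b by omega, Nat.choose_self] at h2
    rw [← h2] at h1
    exact h1
  set P := ((powersetCard b V).powerset ×ˢ (powersetCard b V).powerset).filter
    (fun p => p.1.Nonempty ∧ p.2.Nonempty ∧ ∀ A ∈ p.1, ∀ B ∈ p.2, (A ∩ B).Nonempty) with hP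
  have memP : ∀ X Y : Finset (Finset α), (X, Y) ∈ P ↔ (X ⊆ powersetCard b V ∧
      Y ⊆ powersetCard b V) ∧ X.Nonempty ∧ Y.Nonempty ∧ ∀ A ∈ X, ∀ B ∈ Y, (A ∩ B).Nonempty := by
    intro X Y
    rw [hP, mem_filter, mem_product, mem_powerset, mem_powerset]
  have hFGP : (F, G) ∈ P := (memP F G).2 ⟨⟨hF, hG⟩, hF0, hG0, hFG⟩
  obtain ⟨p, hp, hmax⟩ := exists_max_image P (fun p => #p.1 + #p.2) ⟨_, hFGP⟩
  -- Among the pairs of maximum total size, take one whose second family is smallest.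
  obtain ⟨⟨X, Y⟩, hXY, hmin⟩ := exists_min_image {q ∈ P | #p.1 + #p.2 ≤ #q.1 + #q.2}
    (fun q => #q.2) ⟨p, mem_filter.2 ⟨hp, le_rfl⟩⟩
  rw [mem_filter] at hXY
  obtain ⟨hXYP, hXYp⟩ := hXY
  dsimp only at hXYp
  have hmax' : ∀ X' Y', (X', Y') ∈ P → #X' + #Y' ≤ #X + #Y := fun X' Y' h =>
    (hmax (X', Y') h).trans hXYp
  have hmin' : ∀ X' Y', (X', Y') ∈ P → #X + #Y ≤ #X' + #Y' → #Y ≤ #Y' := fun X' Y' h h' =>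
    hmin (X', Y') (mem_filter.2 ⟨h, hXYp.trans h'⟩)
  refine (hmax' F G hFGP).trans ?_
  obtain ⟨⟨hX, hY⟩, hX0, hY0, hcr⟩ := (memP X Y).1 hXYP
  have hle : #Y ≤ #X := by
    refine hmin' Y X ((memP Y X).2 ⟨⟨hY, hX⟩, hY0, hX0, fun A hA B hB => ?_⟩) (by omega)
    rw [inter_comm]
    exact hcr B hB A hA
  -- Uncrossing: (X ∪ σX, Y ∩ σY) and (X ∩ σX, Y ∪ σY) together have twice the maximum size. If both
  -- are admissible, both are optimal, and minimality of Y gives σY = Y.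
  have hblock : ∀ u ∈ V, ∀ v ∈ V, ∀ B ∈ Y, Equiv.swap u v • B ∈ Y → Equiv.swap u v • Y = Y := by
    intro u hu v hv B hB hB'
    set σ := Equiv.swap u v
    have hσ : ∀ Z : Finset (Finset α), Z ⊆ powersetCard b V → σ • Z ⊆ powersetCard b V := by
      intro Z hZ A hA
      obtain ⟨A', hA', rfl⟩ := mem_smul_finset.1 hA
      exact smul_mem_powersetCard hu hv (hZ hA')
    have hcrσ : ∀ A ∈ σ • X, ∀ B ∈ σ • Y, (A ∩ B).Nonempty := by
      intro A hA B hB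
      obtain ⟨A', hA', rfl⟩ := mem_smul_finset.1 hA
      obtain ⟨B', hB', rfl⟩ := mem_smul_finset.1 hB
      rw [← smul_finset_inter]
      exact (hcr A' hA' B' hB').smul_finset
    have hI : (Y ∩ σ • Y).Nonempty := ⟨σ • B, mem_inter.2 ⟨hB', smul_mem_smul_finset hB⟩⟩
    have h1 : (X ∪ σ • X, Y ∩ σ • Y) ∈ P := by
      refine (memP _ _).2 ⟨⟨union_subset hX (hσ X hX), inter_subset_left.trans hY⟩,
        hX0.mono subset_union_left, hI, fun A hA B hB => ?_⟩
      rw [mem_inter] at hB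
      rcases mem_union.1 hA with hA | hA
      · exact hcr A hA B hB.1
      · exact hcrσ A hA B hB.2
    have h2 := hmax' _ _ h1
    have h3 := card_union_add_card_inter X (σ • X)
    have h4 := card_union_add_card_inter Y (σ • Y)
    have h5 := card_pos.2 hI
    rw [card_smul_finset] at h3 h4
    -- Maximality gives #(X ∩ σX) ≥ #X - #Y + #(Y ∩ σY), which is positive since #Y ≤ #X.
    have h6 : (X ∩ σ • X).Nonempty := card_pos.1 (by omega)
    have h7 : (X ∩ σ • X, Y ∪ σ • Y) ∈ P := by
      refine (memP _ _).2 ⟨⟨inter_subset_left.trans hX, union_subset hY (hσ Y hY)⟩,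
        h6, hY0.mono subset_union_left, fun A hA B hB => ?_⟩
      rw [mem_inter] at hA
      rcases mem_union.1 hB with hB | hB
      · exact hcr A hA.1 B hB
      · exact hcrσ A hA.2 B hB
    have h8 := hmax' _ _ h7
    have h9 := hmin' _ _ h1 (by omega)
    have h10 : Y ∩ σ • Y = Y := eq_of_subset_of_card_le inter_subset_left h9
    exact (eq_of_subset_of_card_le (inter_eq_left.1 h10) (card_smul_finset σ Y).le).symm
  obtain ⟨A, hA⟩ := hX0
  have h1 := card_le_one_of_block hn (hX hA) hY (hcr A hA) hblock
  obtain ⟨B, hB⟩ := hY0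
  have hBV := mem_powersetCard.1 (hY hB)
  refine add_le_add ?_ h1
  rw [← hBV.2, ← card_filter_meet_one _ (by omega) hBV.1, hBV.2]
  exact card_le_card fun A hA => mem_filter.2 ⟨hX hA, hcr A hA B hB⟩

end Swap
end CrossCover
-- Cross systems and the slice bound.
namespace CrossCover
open Finset
variable {α : Type*} [DecidableEq α]

/-- `F` consists of `a`-subsets of `V`, `H` of subsets of `V` with at most `b` elements, the two
families are cross-intersecting, and no set with fewer than `t` elements is a cover of `H`. -/
structure CrossSystem (V : Finset α) (a b t : ℕ) (F H : Finset (Finset α)) : Prop where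
  left : F ⊆ powersetCard a V
  right : ∀ B ∈ H, B ⊆ V ∧ #B ≤ b
  cross : ∀ A ∈ F, ∀ B ∈ H, (A ∩ B).Nonempty
  hard : ∀ T : Finset α, #T < t → ∃ B ∈ H, Disjoint T B

variable {V : Finset α} {a b t : ℕ} {F H : Finset (Finset α)}

/-- Adding x to a cover of the link gives a cover of `H`; hence the loss of one in t. -/
theorem CrossSystem.link (S : CrossSystem V a b t F H) (x : α) :
    CrossSystem (V.erase x) (a - 1) b (t - 1) (F.memberSubfamily x) (H.nonMemberSubfamily x) where
  left := by
    intro A hA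
    rw [mem_memberSubfamily] at hA
    have h := mem_powersetCard.1 (S.left hA.1)
    rw [card_insert_of_notMem hA.2] at h
    exact mem_powersetCard.2
      ⟨subset_erase.2 ⟨(subset_insert x A).trans h.1, hA.2⟩, by omega⟩
  right := by
    intro B hB
    rw [mem_nonMemberSubfamily] at hB
    exact ⟨subset_erase.2 ⟨(S.right B hB.1).1, hB.2⟩, (S.right B hB.1).2⟩
  cross := by
    intro A hA B hB
    rw [mem_memberSubfamily] at hA
    rw [mem_nonMemberSubfamily] at hB
    exact (insert_inter_nonempty hB.2).1 (S.cross _ hA.1 B hB.1)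
  hard := by
    intro T hT
    obtain ⟨B, hB, hTB⟩ := S.hard (insert x T) ((card_insert_le x T).trans_lt (by omega))
    rw [disjoint_insert_left] at hTB
    exact ⟨B, mem_nonMemberSubfamily.2 ⟨hB, hTB.1⟩, hTB.2⟩

/-- Deleting x shrinks the members of `H`, so covers do not become easier, while sets of `F`
avoiding x still meet what is left. Uniformity of `H` is lost here. -/
theorem CrossSystem.trace (S : CrossSystem V a b t F H) (x : α) :
    CrossSystem (V.erase x) a b t (F.nonMemberSubfamily x) (H.image (erase · x)) where
  left := by
    intro A hA
    rw [mem_nonMemberSubfamily] at hA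
    have h := mem_powersetCard.1 (S.left hA.1)
    exact mem_powersetCard.2 ⟨subset_erase.2 ⟨h.1, hA.2⟩, h.2⟩
  right := by
    intro B hB
    obtain ⟨B, hBH, rfl⟩ := mem_image.1 hB
    exact ⟨erase_subset_erase x (S.right B hBH).1, card_erase_le.trans (S.right B hBH).2⟩
  cross := by
    intro A hA B hB
    obtain ⟨B, hBH, rfl⟩ := mem_image.1 hB
    rw [mem_nonMemberSubfamily] at hA
    rw [inter_erase, ← erase_inter, erase_eq_of_notMem hA.2]
    exact S.cross A hA.1 B hBH
  hard := by
    intro T hT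
    obtain ⟨B, hB, hTB⟩ := S.hard T hT
    exact ⟨_, mem_image_of_mem _ hB, hTB.mono_right (erase_subset x B)⟩

theorem slice_nonMemberSubfamily (H : Finset (Finset α)) (x : α) (j : ℕ) :
    (H.nonMemberSubfamily x).slice j = (H.slice j).nonMemberSubfamily x := by
  ext B
  simp only [mem_slice, mem_nonMemberSubfamily]
  tauto

theorem memberSubfamily_slice_subset (H : Finset (Finset α)) (x : α) (j : ℕ) :
    (H.slice (j + 1)).memberSubfamily x ⊆ (H.image (erase · x)).slice j := by
  intro B hB
  rw [mem_memberSubfamily, mem_slice] at hB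
  rw [mem_slice, mem_image]
  refine ⟨⟨_, hB.1.1, erase_insert hB.2⟩, ?_⟩
  have := hB.1.2
  rw [card_insert_of_notMem hB.2] at this
  omega

theorem card_slice_eq (H : Finset (Finset α)) (x : α) (j : ℕ) :
    #(H.slice j) =
      #((H.slice j).memberSubfamily x) + #((H.nonMemberSubfamily x).slice j) := by
  rw [slice_nonMemberSubfamily, card_memberSubfamily_add_card_nonMemberSubfamily]

theorem CrossSystem.card_left_le (S : CrossSystem V a b t F H) : #F ≤ (#V).choose a := by
  rw [← card_powersetCard]
  exact card_le_card S.left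

theorem CrossSystem.slice_subset_powersetCard (S : CrossSystem V a b t F H) (j : ℕ) :
    H.slice j ⊆ powersetCard j V := by
  intro B hB
  rw [mem_slice] at hB
  exact mem_powersetCard.2 ⟨(S.right B hB.1).1, hB.2⟩

theorem CrossSystem.card_pos (S : CrossSystem V a b t F H) (hF : F.Nonempty) {B : Finset α}
    (hB : B ∈ H) : 1 ≤ #B := by
  obtain ⟨A, hA⟩ := hF
  exact Finset.card_pos.2 ((S.cross A hA B hB).mono inter_subset_right)

/-- A family of nonempty sets without covers of size less than `t` has at least `t` members. -/
theorem le_card_of_hard {t : ℕ} {H : Finset (Finset α)} (h0 : ∀ B ∈ H, B.Nonempty)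
    (hard : ∀ T : Finset α, #T < t → ∃ B ∈ H, Disjoint T B) : t ≤ #H := by
  by_contra! hlt
  obtain ⟨B, hB, -⟩ := hard ∅ (by rw [card_empty]; omega)
  have : Nonempty α := ⟨(h0 B hB).choose⟩
  choose! f hf using h0
  obtain ⟨B, hB, hd⟩ := hard (H.image f) (card_image_le.trans_lt hlt)
  exact disjoint_left.1 hd (mem_image_of_mem f hB) (hf B hB)

/-- If moreover there are exactly `t` members, they are pairwise disjoint. -/
theorem pairwiseDisjoint_of_hard {t : ℕ} {H : Finset (Finset α)} (h0 : ∀ B ∈ H, B.Nonempty)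
    (hard : ∀ T : Finset α, #T < t → ∃ B ∈ H, Disjoint T B) (ht : #H ≤ t) :
    (H : Set (Finset α)).PairwiseDisjoint id := by
  intro B hB C hC hne
  rw [Function.onFun, id, id, disjoint_left]
  intro x hxB hxC
  -- If x lies in two members, the members avoiding x still need t - 1 points to be covered, which
  -- makes at least t + 1 members in all.
  have h1 : t - 1 ≤ #(H.filter (x ∉ ·)) := by
    refine le_card_of_hard (fun B hB => h0 B (mem_filter.1 hB).1) fun T hT => ?_
    obtain ⟨D, hD, hd⟩ := hard (insert x T) ((card_insert_le x T).trans_lt (by omega))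
    rw [disjoint_insert_left] at hd
    exact ⟨D, mem_filter.2 ⟨hD, hd.1⟩, hd.2⟩
  have h2 : ({B, C} : Finset (Finset α)) ⊆ H.filter (fun D => ¬ x ∉ D) := by
    intro D hD
    rw [mem_insert, mem_singleton] at hD
    rcases hD with rfl | rfl
    · exact mem_filter.2 ⟨hB, not_not.2 hxB⟩
    · exact mem_filter.2 ⟨hC, not_not.2 hxC⟩
  have h3 := card_le_card h2
  rw [card_pair hne] at h3
  have h4 := card_filter_add_card_filter_not (s := H) (fun D => x ∉ D)
  omega

/-- The bound on `#F + #(H.slice j)` for a cross system. -/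
def SliceBound (V : Finset α) (a b t : ℕ) (F H : Finset (Finset α)) : Prop :=
  ∀ j, 1 ≤ j → j ≤ b → a + j ≤ #V → (H.slice j).Nonempty →
    #F + #(H.slice j) ≤ meetCountWith b t j #V a + if j = b then t + 1 else 1

theorem meetCountWith_add_one_le {t j n : ℕ} (hj : j < b) (ha : b + t ≤ a) (hn : a + j ≤ n) :
    meetCountWith b t j n a + 1 ≤ meetCount b (t + 1) n a := by
  refine le_trans ?_ (meetCountWith_add_le_meetCount_succ hj)
  have := choose_le_meetCount (b := b) (t := t) (n := n - 1 - j) (a := a - 1) (k := 0)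
    (by omega) (by omega) (by omega)
  rw [Nat.choose_zero_right] at this
  omega

/-- A member smaller than b gives a slice bound with room to spare. Otherwise `H` is uniform with at
least t + 1 members, which pay for the surplus t + 1 in the top slice bound. -/
theorem CrossSystem.card_le_of_sliceBound (S : CrossSystem V a b (t + 1) F H) (ha : b + t ≤ a)
    (hF : F.Nonempty) (hB : SliceBound V a b t F H) : #F ≤ meetCount b (t + 1) #V a := by
  rcases Nat.lt_or_ge #V (a + b) with hn | hn
  · exact S.card_left_le.trans (choose_le_meetCount_of_lt hn)
  by_cases h : ∃ B ∈ H, #B < b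
  · obtain ⟨B, hBH, hBb⟩ := h
    have h1 := hB #B (S.card_pos hF hBH) hBb.le (by omega) ⟨B, mem_slice.2 ⟨hBH, rfl⟩⟩
    rw [if_neg hBb.ne] at h1
    have h2 := meetCountWith_add_one_le (n := #V) hBb ha (by omega)
    omega
  · push Not at h
    have h1 : H.slice b = H := filter_true_of_mem fun B hB => le_antisymm (S.right B hB).2 (h B hB)
    have h2 := le_card_of_hard (fun B hB => Finset.card_pos.1 (S.card_pos hF hB)) S.hard
    obtain ⟨B, hBH⟩ : H.Nonempty := Finset.card_pos.1 (by omega)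
    have h3 := hB b ((S.card_pos hF hBH).trans (S.right B hBH).2) le_rfl hn
      (by rw [h1]; exact ⟨B, hBH⟩)
    rw [if_pos rfl, h1, ← meetCount_succ] at h3
    omega

/-- The form in which links are used, where the slice may be empty. `SliceBound` is a hypothesis so
that the lemma is available inside the induction that proves it. -/
theorem CrossSystem.card_add_card_slice_le_of_sliceBound (S : CrossSystem V a b t F H)
    (ha : b + t ≤ a + 1) (hF : F.Nonempty) {j : ℕ} (hj1 : 1 ≤ j) (hj : j ≤ b) (hn : a + j ≤ #V)
    (h0 : t = 0 → j ≤ a) (hB : 1 ≤ t → SliceBound V a b (t - 1) F H) :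
    #F + #(H.slice j) ≤ meetCount b t #V a + if j = b then t else 0 := by
  cases t with
  | zero =>
    refine le_add_right ?_
    exact card_add_card_le_choose S.left (S.slice_subset_powersetCard j)
      (fun A hA B hB => S.cross A hA B (Finset.slice_subset hB)) (h0 rfl) hn
  | succ t =>
    have hB := hB (by omega)
    rw [Nat.add_sub_cancel] at hB
    rcases (H.slice j).eq_empty_or_nonempty with h | h
    · rw [h, card_empty]
      exact le_add_right (S.card_le_of_sliceBound (by omega) hF hB)
    · have h1 := hB j hj1 hj hn h
      rcases hj.eq_or_lt with rfl | hj
      · rw [if_pos rfl] at h1 ⊢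
        rwa [meetCount_succ]
      · rw [if_neg hj.ne] at h1 ⊢
        have h2 := meetCountWith_add_one_le (n := #V) hj (show b + t ≤ a by omega) hn
        omega

theorem exists_link_point (S : CrossSystem V a b t F H) (hF : F.Nonempty) {j : ℕ}
    (hH : (H.slice j).Nonempty) : ∃ x ∈ V, (F.memberSubfamily x).Nonempty ∧
      ((H.slice j).memberSubfamily x).Nonempty := by
  obtain ⟨A, hA⟩ := hF
  obtain ⟨B, hB⟩ := hH
  obtain ⟨x, hx⟩ := S.cross A hA B (Finset.slice_subset hB)
  rw [mem_inter] at hx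
  refine ⟨x, (mem_powersetCard.1 (S.left hA)).1 hx.1, ⟨A.erase x, ?_⟩, ⟨B.erase x, ?_⟩⟩
  · rw [mem_memberSubfamily, insert_erase hx.1]
    exact ⟨hA, notMem_erase x A⟩
  · rw [mem_memberSubfamily, insert_erase hx.2]
    exact ⟨hB, notMem_erase x B⟩

theorem card_memberSubfamily_slice_le (S : CrossSystem V a b t F H) {x : α} (hx : x ∈ V) (j : ℕ) :
    #((H.slice (j + 1)).memberSubfamily x) ≤ (#V - 1).choose j := by
  rw [← card_erase_of_mem hx, ← card_powersetCard]
  exact card_le_card ((memberSubfamily_slice_subset H x j).trans ((S.trace x).slice_subset_powersetCard j))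

/-- Induction on the ground set: at a point common to a member of `F` and one of the slice, the link
and the trace contribute the two terms of `meetCountWith_succ`. -/
theorem CrossSystem.sliceBound (S : CrossSystem V a b (t + 1) F H) (ha : b + t ≤ a)
    (hF : F.Nonempty) : SliceBound V a b t F H := by
  induction hn : #V generalizing V a t F H with
  | zero =>
    intro j hj1 hjb hnj
    omega
  | succ n ih =>
    intro j hj1 hjb hnj hH
    -- Here the link would have a - 1 < j, outside the range of `card_add_card_le_choose`.
    by_cases hspec : t = 0 ∧ a = j
    · obtain ⟨rfl, rfl⟩ := hspec
      obtain rfl : b = a := by omega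
      rw [if_pos rfl]
      exact card_add_card_le_of_nonempty hj1 (by omega) S.left (S.slice_subset_powersetCard b)
        (fun A hA B hB => S.cross A hA B (Finset.slice_subset hB)) hF hH
    obtain ⟨x, hxV, hFx, hHx⟩ := exists_link_point S hF hH
    have hVx : #(V.erase x) = n := by rw [card_erase_of_mem hxV]; omega
    obtain ⟨j, rfl⟩ := Nat.exists_eq_add_of_le' hj1
    have h1 : #(F.memberSubfamily x) + #((H.nonMemberSubfamily x).slice (j + 1)) ≤
        meetCount b t n (a - 1) + if j + 1 = b then t else 0 := by
      rw [← hVx]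
      refine (S.link x).card_add_card_slice_le_of_sliceBound (by omega) hFx hj1 hjb (by omega)
        (by omega) fun ht => ?_
      have S' := S.link x
      rw [Nat.add_sub_cancel, show t = t - 1 + 1 by omega] at S'
      exact ih S' (by omega) hFx hVx
    have h2 : #(F.nonMemberSubfamily x) + #((H.slice (j + 1)).memberSubfamily x) ≤
        meetCountWith b t j n a + 1 := by
      rcases (F.nonMemberSubfamily x).eq_empty_or_nonempty with h | h
      · rw [h, card_empty, zero_add]
        refine (card_memberSubfamily_slice_le S hxV j).trans ?_
        rw [hn, Nat.add_sub_cancel]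
        exact choose_le_meetCountWith_add_one (by omega) ha (by omega)
      · have hsub := memberSubfamily_slice_subset H x j
        have hj : 1 ≤ j := by
          obtain ⟨B, hB⟩ := hHx.mono hsub
          rw [mem_slice] at hB
          rw [← hB.2]
          exact (S.trace x).card_pos h hB.1
        have h3 := ih (S.trace x) ha h hVx j hj (by omega) (by omega) (hHx.mono hsub)
        rw [if_neg (by omega), hVx] at h3
        have h4 := card_le_card hsub
        omega
    have h3 := card_memberSubfamily_add_card_nonMemberSubfamily x F
    have h4 := card_slice_eq H x (j + 1)
    rw [hn, meetCountWith_succ, Nat.add_sub_cancel]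
    split_ifs at h1 ⊢ <;> omega

/-- The bound when `j` may be strictly smaller than `b` or the slice may be empty. -/
theorem CrossSystem.card_add_card_slice_le_of_le (S : CrossSystem V a b t F H)
    (ha : b + t ≤ a + 1) (hF : F.Nonempty) {j : ℕ} (hj1 : 1 ≤ j) (hj : j ≤ b)
    (hn : a + j ≤ #V) (h0 : t = 0 → j ≤ a) :
    #F + #(H.slice j) ≤ meetCount b t #V a + if j = b then t else 0 := by
  refine S.card_add_card_slice_le_of_sliceBound ha hF hj1 hj hn h0 fun ht => ?_
  obtain ⟨t, rfl⟩ := Nat.exists_eq_add_of_le' ht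
  exact S.sliceBound (by omega) hF

theorem CrossSystem.card_add_card_slice_le (S : CrossSystem V a b t F H)
    (ha : b + t ≤ a + 1) (ht : 1 ≤ t) (hF : F.Nonempty) {j : ℕ} (hj1 : 1 ≤ j) (hj : j ≤ b)
    (hn : a + j ≤ #V) :
    #F + #(H.slice j) ≤ meetCount b t #V a + if j = b then t else 0 := by
  exact S.card_add_card_slice_le_of_le ha hF hj1 hj hn (by omega)

/-! ### Induction along an irredundant cover. -/

/-- Every point of `S` is the only point of `S` in some member of `F`. -/
def Irredundant (F : Finset (Finset α)) (S : Finset α) : Prop :=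
  ∀ x ∈ S, ∃ A ∈ F, A ∩ S = {x}

theorem Irredundant.memberSubfamily_nonempty {S : Finset α} (h : Irredundant F S) {x : α}
    (hx : x ∈ S) : (F.memberSubfamily x).Nonempty := by
  obtain ⟨A, hA, hAS⟩ := h x hx
  have hxA : x ∈ A := (mem_inter.1 (hAS ▸ mem_singleton_self x)).1
  exact ⟨A.erase x, by rw [mem_memberSubfamily, insert_erase hxA]; exact ⟨hA, notMem_erase x A⟩⟩

theorem Irredundant.erase {S : Finset α} (h : Irredundant F S) {x : α} (hx : x ∈ S) :
    Irredundant (F.nonMemberSubfamily x) (S.erase x) := by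
  intro y hy
  rw [mem_erase] at hy
  obtain ⟨A, hA, hAS⟩ := h y hy.2
  have hxA : x ∉ A := fun hxA => by
    have := hAS ▸ mem_inter.2 ⟨hxA, hx⟩
    exact hy.1 (mem_singleton.1 this).symm
  refine ⟨A, mem_nonMemberSubfamily.2 ⟨hA, hxA⟩, ?_⟩
  rw [inter_erase, hAS, erase_eq_of_notMem (by simpa using hy.1.symm)]

theorem cover_erase {S : Finset α} {x : α} (h : ∀ A ∈ F, (S ∩ A).Nonempty) :
    ∀ A ∈ F.nonMemberSubfamily x, (S.erase x ∩ A).Nonempty := by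
  intro A hA
  rw [mem_nonMemberSubfamily] at hA
  rw [erase_inter, ← inter_erase, erase_eq_of_notMem hA.2]
  exact h A hA.1

/-- The main inequality, for cross systems with an irredundant cover. -/
theorem CrossSystem.card_add_card_slice_le_of_cover {j : ℕ} {C : Finset α}
    (S : CrossSystem V a b (t + 1) F H) (ht : 1 ≤ t) (ha : b + t ≤ a) (hj : j ≤ b)
    (hn : a + j ≤ #V) (hCV : C ⊆ V) (hCj : #C ≤ j) (hC : ∀ A ∈ F, (C ∩ A).Nonempty)
    (hirr : Irredundant F C) :
    #F + #(H.slice j) ≤ meetCountWith b t #C #V a + (#V - #C).choose (j - #C) +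
      if j = b then t else 0 := by
  induction C using Finset.induction_on generalizing V F H j with
  | empty =>
    have hF : F = ∅ := by
      refine eq_empty_of_forall_notMem fun A hA => ?_
      simpa using hC A hA
    rw [hF, card_empty, zero_add, card_empty, meetCountWith_zero, zero_add, Nat.sub_zero, Nat.sub_zero,
      ← card_powersetCard]
    exact le_add_right (card_le_card (S.slice_subset_powersetCard j))
  | insert x C hxC ih =>
    rw [card_insert_of_notMem hxC] at hCj ⊢
    have hxV : x ∈ V := hCV (mem_insert_self x C)
    have hxI : x ∈ insert x C := mem_insert_self x C
    have hVx : #(V.erase x) = #V - 1 := card_erase_of_mem hxV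
    -- Irredundance makes the sets of `F` through x nonempty, as the link bound requires.
    have h1 := (S.link x).card_add_card_slice_le (by omega) (by omega)
      (hirr.memberSubfamily_nonempty hxI) (j := j) (by omega) hj (by omega)
    obtain ⟨j, rfl⟩ := Nat.exists_eq_add_of_le' (show 1 ≤ j by omega)
    have hirr' := hirr.erase hxI
    have hC' := cover_erase (x := x) hC
    rw [erase_insert hxC] at hirr' hC'
    have h2 := ih (S.trace x) (j := j) (by omega) (by omega)
      (subset_erase.2 ⟨(insert_subset_iff.1 hCV).2, hxC⟩) (by omega) hC' hirr'
    have h3 := card_memberSubfamily_add_card_nonMemberSubfamily x F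
    have h4 := card_slice_eq H x (j + 1)
    have h5 := card_le_card (memberSubfamily_slice_subset H x j)
    rw [if_neg (by omega), hVx] at h2
    rw [meetCountWith_succ, Nat.add_sub_add_right, show #V - (#C + 1) = #V - 1 - #C by omega]
    rw [hVx, Nat.add_sub_cancel] at h1
    omega

end CrossCover
-- Strictness and uniqueness in the slice bound.
namespace CrossCover
open Finset
variable {α : Type*} [DecidableEq α]
variable {V : Finset α} {a b t : ℕ} {F H : Finset (Finset α)}

theorem meetCountWith_add_one_lt {j n : ℕ} (hb : 2 ≤ b) (hj : j < b) (ha : b + t ≤ a)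
    (hn : a + j < n) : meetCountWith b t j n a + 1 < meetCount b (t + 1) n a := by
  refine lt_of_lt_of_le ?_ (meetCountWith_add_le_meetCount_succ hj)
  have := choose_le_meetCount (b := b) (t := t) (n := n - 1 - j) (a := a - 1) (k := 1)
    (by omega) (by omega) (by omega)
  rw [Nat.choose_one_right] at this
  omega

/-- Apply the slice bound with no disjoint sets and b = j. It falls short of the full layer by
C(n-j, a) - 1, which is positive as n > a + j. -/
theorem card_add_card_lt_choose {G : Finset (Finset α)} {j : ℕ}
    (hF : F ⊆ powersetCard a V) (hG : G ⊆ powersetCard j V)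
    (hFG : ∀ A ∈ F, ∀ B ∈ G, (A ∩ B).Nonempty) (hj1 : 1 ≤ j) (hj : j ≤ a) (hn : a + j < #V)
    (hF0 : F.Nonempty) (hG0 : G.Nonempty) : #F + #G < (#V).choose a := by
  have S : CrossSystem V a j (0 + 1) F G := by
    refine ⟨hF, fun B hB => ?_, hFG, fun T hT => ?_⟩
    · have := mem_powersetCard.1 (hG hB)
      exact ⟨this.1, this.2.le⟩
    · obtain ⟨B, hB⟩ := hG0
      rw [card_eq_zero.1 (show #T = 0 by omega)]
      exact ⟨B, hB, disjoint_empty_left B⟩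
  have hs : G.slice j = G := filter_true_of_mem fun B hB => (mem_powersetCard.1 (hG hB)).2
  have h1 := S.sliceBound (by omega) hF0 j hj1 le_rfl hn.le (by rwa [hs])
  rw [hs, if_pos rfl] at h1
  have h2 := sum_choose_add_choose a j #V (by omega) (by omega)
  have h3 : (#V - j).choose 0 < (#V - j).choose a := choose_lt_choose (by omega) (by omega)
  rw [Nat.choose_zero_right] at h3
  simp only [meetCountWith, meetCount_zero] at h1
  omega

/-- Below the top slice, or without covering condition, the inequality is strict. -/
theorem CrossSystem.card_add_card_slice_lt (S : CrossSystem V a b t F H)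
    (ha : b + t ≤ a + 1) (hF : F.Nonempty) {j : ℕ} (hj1 : 1 ≤ j) (hja : j ≤ a)
    (hn : a + j < #V) (hj : t = 0 ∨ j < b) (hH : (H.slice j).Nonempty) :
    #F + #(H.slice j) < meetCount b t #V a := by
  cases t with
  | zero =>
    exact card_add_card_lt_choose S.left (S.slice_subset_powersetCard j)
      (fun A hA B hB => S.cross A hA B (Finset.slice_subset hB)) hj1 hja hn hF hH
  | succ t =>
    have hj : j < b := by omega
    have h1 := S.sliceBound (by omega) hF j hj1 hj.le hn.le hH
    rw [if_neg hj.ne] at h1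
    exact h1.trans_lt (meetCountWith_add_one_lt (by omega) hj (by omega) hn)

/-- The part of the bound that concerns the sets of `F` avoiding `x` and of `H` containing `x`. -/
theorem CrossSystem.card_add_card_memberSubfamily_le (S : CrossSystem V a b (t + 1) F H)
    (ha : b + t ≤ a) {x : α} (hx : x ∈ V) {j : ℕ} (hj : j < b) (hn : a + (j + 1) ≤ #V)
    (hH : ((H.slice (j + 1)).memberSubfamily x).Nonempty) :
    #(F.nonMemberSubfamily x) + #((H.slice (j + 1)).memberSubfamily x) ≤
      meetCountWith b t j (#V - 1) a + 1 := by
  rcases (F.nonMemberSubfamily x).eq_empty_or_nonempty with h | h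
  · rw [h, card_empty, zero_add]
    refine (card_memberSubfamily_slice_le S hx j).trans ?_
    exact choose_le_meetCountWith_add_one (by omega) ha (by omega)
  · have hsub := memberSubfamily_slice_subset H x j
    have hVx : #(V.erase x) = #V - 1 := card_erase_of_mem hx
    have hj : 1 ≤ j := by
      obtain ⟨B, hB⟩ := hH.mono hsub
      rw [mem_slice] at hB
      rw [← hB.2]
      exact (S.trace x).card_pos h hB.1
    have h3 := (S.trace x).sliceBound ha h j hj (by omega) (by omega) (hH.mono hsub)
    rw [if_neg (by omega), hVx] at h3
    have h4 := card_le_card hsub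
    omega

/-- Uniqueness below the top slice: equality forces the slice to be a singleton. -/
theorem CrossSystem.card_slice_le_one (S : CrossSystem V a b (t + 1) F H) (ha : b + t ≤ a)
    (hF : F.Nonempty) {j : ℕ} (hj1 : 1 ≤ j) (hj : j < b) (hn : a + j < #V)
    (heq : meetCountWith b t j #V a + 1 ≤ #F + #(H.slice j)) : #(H.slice j) ≤ 1 := by
  induction j generalizing V F H with
  | zero => omega
  | succ j ih =>
    rcases (H.slice (j + 1)).eq_empty_or_nonempty with hH | hH
    · rw [hH, card_empty]; exact Nat.zero_le _
    obtain ⟨x, hxV, hFx, hHx⟩ := exists_link_point S hF hH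
    have hVx : #(V.erase x) = #V - 1 := card_erase_of_mem hxV
    have h1 := (S.link x).card_add_card_slice_le_of_le (by omega) hFx hj1 hj.le (by omega)
      (by omega)
    have h2 := S.card_add_card_memberSubfamily_le ha hxV (by omega) hn.le hHx
    have h3 := card_memberSubfamily_add_card_nonMemberSubfamily x F
    have h4 := card_slice_eq H x (j + 1)
    rw [meetCountWith_succ] at heq
    rw [if_neg hj.ne, hVx, Nat.add_sub_cancel] at h1
    -- Equality makes the link tight, while a nonempty slice would make it strict; so every set of
    -- the slice contains x.
    have h5 : (H.nonMemberSubfamily x).slice (j + 1) = ∅ := by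
      by_contra hne
      have := (S.link x).card_add_card_slice_lt (by omega) hFx hj1 (by omega) (by omega)
        (Or.inr hj) (nonempty_iff_ne_empty.2 hne)
      rw [hVx, Nat.add_sub_cancel] at this
      omega
    rw [h5, card_empty] at h1 h4
    have hle := card_memberSubfamily_slice_le S hxV j
    rcases Nat.eq_zero_or_pos j with rfl | hj0
    · rw [Nat.choose_zero_right] at hle
      omega
    rcases (F.nonMemberSubfamily x).eq_empty_or_nonempty with h | h
    · rw [h, card_empty] at h2 h3
      have := choose_lt_meetCountWith_add_one (b := b) (t := t) (n := #V - 1) (a := a) (k := j)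
        (by omega) hj0 ha (by omega) (by omega)
      omega
    · have hle' := card_le_card (memberSubfamily_slice_subset H x j)
      have := ih (S.trace x) h hj0 (by omega) (by omega) (by rw [hVx]; omega)
      omega

/-- Two distinct sets to be met cost at least `b` more members than one. -/
theorem card_add_le_of_meet_two {B C : Finset α} (hb : 1 ≤ b) (hn : 2 * b < #V)
    (hF : F ⊆ powersetCard b V) (hB : B ∈ powersetCard b V) (hC : C ∈ powersetCard b V)
    (hne : B ≠ C) (hFB : ∀ A ∈ F, (A ∩ B).Nonempty) (hFC : ∀ A ∈ F, (A ∩ C).Nonempty) :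
    #F + b ≤ meetCountWith b 0 b #V b := by
  rw [mem_powersetCard] at hB hC
  obtain ⟨u, huB, huC⟩ : ∃ u ∈ B, u ∉ C := by
    by_contra! h
    exact hne (eq_of_subset_of_card_le h (by omega))
  -- These b-sets contain u and avoid C, so they meet B but cannot lie in `F`. There are C(n-b-1,
  -- b-1) ≥ C(b, b-1) = b of them.
  set E := (powersetCard (b - 1) ((V \ C).erase u)).image (insert u) with hE
  have hEc : b ≤ #E := by
    have hc : #((V \ C).erase u) = #V - b - 1 := by
      rw [card_erase_of_mem (mem_sdiff.2 ⟨hB.1 huB, huC⟩), card_sdiff_of_subset hC.1, hC.2]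
    rw [hE, card_image_of_injOn, card_powersetCard, hc]
    · have h1 := Nat.choose_mono (b - 1) (show b ≤ #V - b - 1 by omega)
      have h2 : b.choose (b - 1) = b := by
        rw [← Nat.choose_symm_of_eq_add (n := b) (a := 1) (b := b - 1) (by omega),
          Nat.choose_one_right]
      dsimp only at h1
      omega
    · intro X hX Y hY hXY
      have hX' : u ∉ X := fun h => notMem_erase u _ ((mem_powersetCard.1 hX).1 h)
      have hY' : u ∉ Y := fun h => notMem_erase u _ ((mem_powersetCard.1 hY).1 h)
      rw [← erase_insert hX', ← erase_insert hY']
      exact congrArg (fun Z => Z.erase u) hXY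
  have hsub : F ∪ E ⊆ {A ∈ powersetCard b V | (A ∩ B).Nonempty} := by
    intro A hA
    rw [mem_filter]
    rcases mem_union.1 hA with hA | hA
    · exact ⟨hF hA, hFB A hA⟩
    · obtain ⟨X, hX, rfl⟩ := mem_image.1 hA
      rw [mem_powersetCard, subset_erase] at hX
      refine ⟨mem_powersetCard.2 ⟨insert_subset (hB.1 huB) (hX.1.1.trans sdiff_subset), ?_⟩,
        ⟨u, mem_inter.2 ⟨mem_insert_self u X, huB⟩⟩⟩
      rw [card_insert_of_notMem hX.1.2]
      omega
  have hdis : Disjoint F E := by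
    rw [disjoint_left]
    intro A hA hAE
    obtain ⟨X, hX, rfl⟩ := mem_image.1 hAE
    rw [mem_powersetCard, subset_erase, subset_sdiff] at hX
    have := hFC _ hA
    rw [insert_inter_nonempty huC] at this
    exact not_disjoint_iff_nonempty_inter.2 this hX.1.1.2
  have h1 := card_le_card hsub
  rw [card_union_of_disjoint hdis, card_filter_meet_one b hb hB.1, hB.2] at h1
  omega

/-- If the sets of `H` containing `x` and those of `F` avoiding it attain the bound, then `x` has
degree one in `H`. -/
theorem CrossSystem.card_memberSubfamily_le_one (S : CrossSystem V a b (t + 1) F H)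
    (ha : b + t ≤ a) (hb : 2 ≤ b) (hn : a + b < #V) (h : 1 ≤ t ∨ b < a ∨ 3 ≤ b) {x : α}
    (hx : x ∈ V) (heq : meetCountWith b t (b - 1) (#V - 1) a + 1 ≤
      #(F.nonMemberSubfamily x) + #((H.slice b).memberSubfamily x)) :
    #((H.slice b).memberSubfamily x) ≤ 1 := by
  obtain ⟨k, rfl⟩ := Nat.exists_eq_add_of_le' (show 1 ≤ b by omega)
  rw [Nat.add_sub_cancel] at heq
  have hVx : #(V.erase x) = #V - 1 := card_erase_of_mem hx
  have hle' := card_le_card (memberSubfamily_slice_subset H x k)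
  rcases (F.nonMemberSubfamily x).eq_empty_or_nonempty with h' | h'
  · rw [h', card_empty] at heq
    have h1 := card_memberSubfamily_slice_le S hx k
    have h2 := choose_lt_meetCountWith_add_one (b := k + 1) (t := t) (n := #V - 1) (a := a)
      (k := k) (by omega) (by omega) ha (by omega) (by omega)
    omega
  · have := (S.trace x).card_slice_le_one ha h' (j := k) (by omega) (by omega) (by omega)
      (by rw [hVx]; omega)
    omega

theorem card_memberSubfamily (H : Finset (Finset α)) (x : α) :
    #(H.memberSubfamily x) = #{B ∈ H | x ∈ B} := by
  have h1 := card_memberSubfamily_add_card_nonMemberSubfamily x H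
  have h2 := card_filter_add_card_filter_not (s := H) (fun B => x ∈ B)
  have h3 : H.nonMemberSubfamily x = {B ∈ H | x ∉ B} := rfl
  rw [h3] at h1
  omega

/-- Uniqueness in the top slice: equality forces `H` to have as few members as possible. -/
theorem CrossSystem.card_le_of_eq (S : CrossSystem V a b (t + 1) F H) (ha : b + t ≤ a)
    (hb : 2 ≤ b) (hF : F.Nonempty) (hu : ∀ B ∈ H, #B = b) (hn : a + b < #V)
    (h : 1 ≤ t ∨ b < a ∨ 3 ≤ b ∧ ∃ z, ∀ B ∈ H, z ∈ B)
    (heq : meetCountWith b t b #V a + (t + 1) ≤ #F + #H) : #H ≤ t + 1 := by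
  induction t generalizing V a F H with
  | zero =>
    have hs : H.slice b = H := filter_true_of_mem hu
    rcases H.eq_empty_or_nonempty with hH | hH
    · rw [hH, card_empty]; exact Nat.zero_le _
    -- If b < a, the link bound at any common point is strict unless its slice is empty. If a = b
    -- that fails, and the assumed common point z of `H` serves instead.
    obtain ⟨x, hxV, hHx, hle⟩ : ∃ x ∈ V, ((H.slice b).memberSubfamily x).Nonempty ∧
        ((H.nonMemberSubfamily x).slice b = ∅ ∨
          #(F.memberSubfamily x) + #((H.nonMemberSubfamily x).slice b) <
            (#V - 1).choose (a - 1)) := by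
      by_cases hba : b < a
      · obtain ⟨x, hxV, hFx, hHx⟩ := exists_link_point S hF (hs.symm ▸ hH)
        have hVx : #(V.erase x) = #V - 1 := card_erase_of_mem hxV
        refine ⟨x, hxV, hHx, ?_⟩
        rcases ((H.nonMemberSubfamily x).slice b).eq_empty_or_nonempty with h0 | h0
        · exact Or.inl h0
        · rw [← hVx]
          exact Or.inr ((S.link x).card_add_card_slice_lt (by omega) hFx (by omega) (by omega)
            (by omega) (Or.inl rfl) h0)
      · obtain ⟨-, z, hz⟩ : 3 ≤ b ∧ ∃ z, ∀ B ∈ H, z ∈ B :=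
          (h.resolve_left (by omega)).resolve_left hba
        obtain ⟨B, hB⟩ := hH
        refine ⟨z, (S.right B hB).1 (hz B hB), ⟨B.erase z, ?_⟩, Or.inl ?_⟩
        · rw [mem_memberSubfamily, insert_erase (hz B hB), hs]
          exact ⟨hB, notMem_erase z B⟩
        · refine eq_empty_of_forall_notMem fun C hC => ?_
          rw [mem_slice, mem_nonMemberSubfamily] at hC
          exact hC.1.2 (hz C hC.1.1)
    have hVx : #(V.erase x) = #V - 1 := card_erase_of_mem hxV
    have h1 := (S.link x).card_left_le
    obtain ⟨k, rfl⟩ := Nat.exists_eq_add_of_le' (show 1 ≤ b by omega)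
    have h2 := S.card_add_card_memberSubfamily_le ha hxV (by omega) hn.le hHx
    have h3 := card_memberSubfamily_add_card_nonMemberSubfamily x F
    have h4 := card_slice_eq H x (k + 1)
    have h5 := S.card_memberSubfamily_le_one ha hb hn (by omega) hxV
    rw [meetCountWith_succ, meetCount_zero] at heq
    rw [Nat.add_sub_cancel] at h5
    rw [hVx] at h1
    rw [hs] at h2 h4 h5
    rcases hle with hle | hle
    · rw [hle, card_empty] at h4
      have := h5 (by omega)
      omega
    · omega
  | succ t ih =>
    have hs : H.slice b = H := filter_true_of_mem hu
    have hHc := le_card_of_hard (fun B hB => Finset.card_pos.1 (S.card_pos hF hB)) S.hard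
    have hH : H.Nonempty := Finset.card_pos.1 (by omega)
    have hpoint : ∀ x ∈ V, (F.memberSubfamily x).Nonempty → (H.memberSubfamily x).Nonempty →
        #(H.memberSubfamily x) ≤ 1 ∧ meetCountWith b t b (#V - 1) (a - 1) + (t + 1) ≤
          #(F.memberSubfamily x) + #(H.nonMemberSubfamily x) := by
      intro x hxV hFx hHx
      have hVx : #(V.erase x) = #V - 1 := card_erase_of_mem hxV
      have h1 := (S.link x).card_add_card_slice_le_of_le (j := b) (by omega) hFx (by omega) le_rfl
        (by omega) (by omega)
      have h5 := S.card_memberSubfamily_le_one ha hb hn (by omega) hxV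
      obtain ⟨k, rfl⟩ := Nat.exists_eq_add_of_le' (show 1 ≤ b by omega)
      have h2 := S.card_add_card_memberSubfamily_le ha hxV (j := k) (by omega) hn.le
        (by rwa [hs])
      have h3 := card_memberSubfamily_add_card_nonMemberSubfamily x F
      have h4 := card_memberSubfamily_add_card_nonMemberSubfamily x H
      rw [meetCountWith_succ] at heq
      rw [if_pos rfl, slice_nonMemberSubfamily, hs, hVx, Nat.add_sub_cancel] at h1
      rw [hs, Nat.add_sub_cancel] at h5
      rw [hs] at h2
      rw [← meetCount_succ]
      exact ⟨h5 (by omega), by omega⟩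
    obtain ⟨x, hxV, hFx, hHx⟩ := exists_link_point S hF (hs.symm ▸ hH)
    rw [hs] at hHx
    have hVx : #(V.erase x) = #V - 1 := card_erase_of_mem hxV
    obtain ⟨h1, h2⟩ := hpoint x hxV hFx hHx
    have h3 := card_memberSubfamily_add_card_nonMemberSubfamily x H
    have hux : ∀ B ∈ H.nonMemberSubfamily x, #B = b := fun B hB =>
      hu B (mem_nonMemberSubfamily.1 hB).1
    suffices h4 : #(H.nonMemberSubfamily x) ≤ t + 1 by omega
    by_cases hex : 1 ≤ t ∨ b < a - 1
    · exact ih (S.link x) (by omega) hFx hux (by omega) (by tauto) (by rw [hVx]; exact h2)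
    · obtain rfl : t = 0 := by omega
      obtain rfl : a = b + 1 := by omega
      -- The induction hypothesis is missing when the link has a - 1 = b and t = 0. Count directly:
      -- points of a member of `F` have degree at most one in `H`, so #H ≤ b + 1. But two members of
      -- `H` avoiding x cost `F` at least b sets, which forces b + 1 members avoiding x, besides one
      -- through x.
      by_contra! hlt
      have hdeg : ∀ A ∈ F, ∀ y ∈ A, #{B ∈ H | y ∈ B} ≤ 1 := by
        intro A hA y hy
        rw [← card_memberSubfamily]
        rcases (H.memberSubfamily y).eq_empty_or_nonempty with h0 | h0
        · rw [h0, card_empty]; exact Nat.zero_le _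
        · refine (hpoint y ((mem_powersetCard.1 (S.left hA)).1 hy) ⟨A.erase y, ?_⟩ h0).1
          rw [mem_memberSubfamily, insert_erase hy]
          exact ⟨hA, notMem_erase y A⟩
      have hHb : #H ≤ b + 1 := by
        obtain ⟨A, hA⟩ := hF
        have hc : H ⊆ A.biUnion fun y => {B ∈ H | y ∈ B} := by
          intro B hB
          obtain ⟨y, hy⟩ := S.cross A hA B hB
          rw [mem_inter] at hy
          exact mem_biUnion.2 ⟨y, hy.1, mem_filter.2 ⟨hB, hy.2⟩⟩
        have := card_biUnion_le_card_mul A (fun y => {B ∈ H | y ∈ B}) 1 (hdeg A hA)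
        rw [mul_one, (mem_powersetCard.1 (S.left hA)).2] at this
        exact (card_le_card hc).trans this
      have hHx1 := Finset.card_pos.2 hHx
      obtain ⟨B, hB, C, hC, hBC⟩ := one_lt_card.1 hlt
      have SL := S.link x
      have hmem : ∀ B ∈ H.nonMemberSubfamily x, B ∈ powersetCard b (V.erase x) := fun B hB =>
        mem_powersetCard.2 ⟨(SL.right B hB).1, hux B hB⟩
      have := card_add_le_of_meet_two (V := V.erase x) (b := b) (by omega) (by omega) SL.left
        (hmem B hB) (hmem C hC) hBC (fun A hA => SL.cross A hA B hB)
        (fun A hA => SL.cross A hA C hC)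
      rw [hVx] at this
      rw [Nat.add_sub_cancel] at h2
      omega

end CrossCover
namespace CrossCover
open Finset

/-! ### Inclusion–exclusion and the closed form of the bound. -/

section Formula

theorem sum_alternating_choose_succ (t : ℕ) (f : ℕ → ℤ) :
    ∑ j ∈ range (t + 2), (-1 : ℤ) ^ j * ((t + 1).choose j : ℤ) * f j =
      ∑ j ∈ range (t + 1), (-1 : ℤ) ^ j * (t.choose j : ℤ) * (f j - f (j + 1)) := by
  have h1 : ∑ j ∈ range (t + 1), (-1 : ℤ) ^ (j + 1) * (t.choose (j + 1) : ℤ) * f (j + 1) + f 0 =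
      ∑ j ∈ range (t + 1), (-1 : ℤ) ^ j * (t.choose j : ℤ) * f j := by
    have h2 := sum_range_succ' (fun j => (-1 : ℤ) ^ j * (t.choose j : ℤ) * f j) (t + 1)
    rw [sum_range_succ] at h2
    simp only [Nat.choose_succ_self, Nat.cast_zero, mul_zero, zero_mul, add_zero, pow_zero,
      Nat.choose_zero_right, Nat.cast_one, one_mul] at h2
    exact h2.symm
  rw [sum_range_succ']
  simp only [Nat.choose_succ_succ', Nat.cast_add, mul_add, add_mul, mul_sub, sum_add_distrib,
    sum_sub_distrib]
  rw [← h1]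
  simp only [pow_succ, mul_neg, mul_one, neg_mul, sum_neg_distrib, pow_zero, Nat.choose_zero_right,
    Nat.cast_one, one_mul]
  ring

/-- By Pascal's rule the alternating sum for t + 1 is that for t applied to differences, and C(m, a)
- C(m-b, a) is the sum over i < b in the definition of `meetCount`. The condition b * t ≤ n keeps
the subtractions exact. -/
theorem meetCount_eq_sum (b : ℕ) {t n a : ℕ} (ha : t ≤ a) (hn : b * t ≤ n) :
    (meetCount b t n a : ℤ) =
      ∑ j ∈ range (t + 1), (-1 : ℤ) ^ j * (t.choose j : ℤ) * ((n - j * b).choose a : ℤ) := by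
  induction t generalizing n a with
  | zero => simp
  | succ t ih =>
    rw [mul_add, mul_one] at hn
    rw [meetCount_succ, meetCountWith, Nat.cast_sum, sum_alternating_choose_succ]
    rw [sum_congr rfl fun i hi => ih (n := n - 1 - i) (a := a - 1) (by omega)
      (by rw [mem_range] at hi; omega)]
    rw [sum_comm]
    refine sum_congr rfl fun j hj => ?_
    rw [← mul_sum]
    congr 1
    have hj' : j * b ≤ b * t := by
      rw [mul_comm]
      exact Nat.mul_le_mul_left b (by rw [mem_range] at hj; omega)
    have h1 := sum_choose_add_choose a b (n - j * b) (by omega) (by omega)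
    rw [add_mul, one_mul, ← Nat.sub_sub, ← h1]
    push_cast
    rw [add_sub_cancel_right]
    refine sum_congr rfl fun i _ => ?_
    congr 2
    omega

theorem sum_Icc_one_eq (m : ℕ) (f : ℕ → ℤ) : ∑ i ∈ Icc 1 m, f i = ∑ i ∈ range m, f (i + 1) := by
  induction m with
  | zero => simp
  | succ m ih => rw [sum_Icc_succ_top (by omega), ih, sum_range_succ]

theorem crossBound_eq {n a b s t : ℕ} (ht : 1 ≤ t) (ha : t ≤ a) (hn : b * t ≤ n) (hs : s ≤ b) :
    crossBound n a b s t =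
      ((meetCountWith b (t - 1) s n a + (n - s).choose (b - s) + (t - 1) : ℕ) : ℤ) := by
  obtain ⟨t, rfl⟩ := Nat.exists_eq_add_of_le' ht
  rw [mul_add, mul_one] at hn
  have h : ∀ i ∈ Icc 1 s, (((n - i).choose (a - 1) : ℤ) + ∑ j ∈ Icc 1 (t + 1 - 1),
      (-1 : ℤ) ^ j * ((t + 1 - 1).choose j : ℤ) * ((n - j * b - i).choose (a - 1) : ℤ)) =
      (meetCount b t (n - i) (a - 1) : ℤ) := by
    intro i hi
    rw [mem_Icc] at hi
    rw [meetCount_eq_sum b (by omega) (by omega), sum_range_succ', Nat.add_sub_cancel,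
      sum_Icc_one_eq, add_comm]
    simp [Nat.sub_right_comm]
  rw [crossBound, sum_congr rfl h, meetCountWith, Nat.add_sub_cancel, sum_Icc_one_eq]
  simp only [Nat.sub_sub, add_comm 1]
  push_cast
  ring

end Formula

/-! ### The extremal configuration. -/

variable {n a b s t : ℕ}

/-- The sets of `F` in the extremal configuration given by `K` and `𝒟`. -/
def extremalLeft (a : ℕ) (K : Finset (Fin n)) (𝒟 : Finset (Finset (Fin n))) :
    Finset (Finset (Fin n)) :=
  {A ∈ powersetCard a univ | (A ∩ K).Nonempty ∧ ∀ D ∈ 𝒟, (A ∩ D).Nonempty}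

/-- The sets of `G` in the extremal configuration given by `K` and `𝒟`. -/
def extremalRight (b : ℕ) (K : Finset (Fin n)) (𝒟 : Finset (Finset (Fin n))) :
    Finset (Finset (Fin n)) :=
  {B ∈ powersetCard b (univ : Finset (Fin n)) | K ⊆ B} ∪ 𝒟

theorem mem_extremalLeft {A K : Finset (Fin n)} {𝒟 : Finset (Finset (Fin n))} :
    A ∈ extremalLeft a K 𝒟 ↔ #A = a ∧ (A ∩ K).Nonempty ∧ ∀ D ∈ 𝒟, (A ∩ D).Nonempty := by
  simp [extremalLeft, mem_powersetCard]

theorem mem_extremalRight {B K : Finset (Fin n)} {𝒟 : Finset (Finset (Fin n))} :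
    B ∈ extremalRight b K 𝒟 ↔ (#B = b ∧ K ⊆ B) ∨ B ∈ 𝒟 := by
  simp [extremalRight, mem_powersetCard]

theorem card_initSegment (h : s ≤ n) : #(initSegment n s) = s := by
  unfold initSegment
  rw [Fin.card_filter_val_lt (n := n)]
  omega

/-- An a-set missing [1,s] leaves at least b ≥ s points outside it, so it also misses some b-set
containing [1,s]. -/
theorem extremalFamily_eq {m : ℕ} (D : Fin m → Finset (Fin n)) (hsb : s ≤ b) (hn : a + b ≤ n) :
    extremalFamily n a b s D = extremalLeft a (initSegment n s) (univ.image D) ∪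
      extremalRight b (initSegment n s) (univ.image D) := by
  unfold extremalFamily
  congr 1
  refine filter_congr fun A hA => ?_
  have hAc := (mem_powersetCard.1 hA).2
  have hs : #(initSegment n s) = s := card_initSegment (by omega)
  constructor
  · intro h
    refine ⟨?_, fun D hD => h D (mem_union_right _ hD)⟩
    by_contra hne
    have hd : initSegment n s ⊆ univ \ A := by
      rw [subset_sdiff]
      refine ⟨subset_univ _, ?_⟩
      rwa [disjoint_comm, disjoint_iff_inter_eq_empty, ← not_nonempty_iff_eq_empty]
    obtain ⟨B, h1, h2, h3⟩ := exists_subsuperset_card_eq (n := b) hd (by omega) (by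
      rw [card_sdiff_of_subset (subset_univ A), card_univ, Fintype.card_fin]
      omega)
    refine not_disjoint_iff_nonempty_inter.2 (h B (mem_union_left _ ?_)) (subset_sdiff.1 h2).2.symm
    exact mem_filter.2 ⟨mem_powersetCard.2 ⟨subset_univ _, h3⟩, h1⟩
  · rintro ⟨h1, h2⟩ B hB
    rcases mem_union.1 hB with hB | hB
    · exact h1.mono (inter_subset_inter_left (mem_filter.1 hB).2)
    · exact h2 B hB

theorem card_extremalLeft {K : Finset (Fin n)} {𝒟 : Finset (Finset (Fin n))} (ha : #𝒟 + 1 ≤ a)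
    (hD : ∀ D ∈ 𝒟, #D = b) (hDK : ∀ D ∈ 𝒟, Disjoint D K)
    (hpd : (𝒟 : Set (Finset (Fin n))).PairwiseDisjoint id) :
    #(extremalLeft a K 𝒟) = meetCountWith b #𝒟 #K n a := by
  have h := card_filter_meet_with rfl ha hpd (subset_univ K)
    (fun D h => ⟨hD D h, subset_univ D⟩) hDK
  rw [card_univ, Fintype.card_fin] at h
  rw [← h, extremalLeft]
  congr

theorem card_filter_superset (K : Finset (Fin n)) (hK : #K ≤ b) :
    #{B ∈ powersetCard b (univ : Finset (Fin n)) | K ⊆ B} = (n - #K).choose (b - #K) := by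
  have h : (n - #K).choose (b - #K) = #(powersetCard (b - #K) (univ \ K)) := by
    rw [card_powersetCard, card_sdiff_of_subset (subset_univ K), card_univ, Fintype.card_fin]
  rw [h]
  refine card_bij' (fun B _ => B \ K) (fun C _ => C ∪ K) ?_ ?_ ?_ ?_
  · intro B hB
    simp only [mem_filter, mem_powersetCard] at hB ⊢
    rw [card_sdiff_of_subset hB.2, hB.1.2]
    exact ⟨sdiff_subset_sdiff (subset_univ B) le_rfl, rfl⟩
  · intro C hC
    simp only [mem_filter, mem_powersetCard, subset_sdiff] at hC ⊢
    rw [card_union_of_disjoint hC.1.2]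
    exact ⟨⟨subset_univ _, by omega⟩, subset_union_right⟩
  · intro B hB
    exact sdiff_union_of_subset (mem_filter.1 hB).2
  · intro C hC
    rw [mem_powersetCard, subset_sdiff] at hC
    exact union_sdiff_cancel_right hC.1.2

theorem card_extremalRight {K : Finset (Fin n)} {𝒟 : Finset (Finset (Fin n))} (hK1 : 1 ≤ #K)
    (hK : #K ≤ b) (hDK : ∀ D ∈ 𝒟, Disjoint D K) :
    #(extremalRight b K 𝒟) = (n - #K).choose (b - #K) + #𝒟 := by
  rw [← card_filter_superset K hK]
  refine card_union_of_disjoint ?_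
  rw [disjoint_left]
  intro B hB hB'
  obtain ⟨x, hx⟩ := Finset.card_pos.1 hK1
  exact disjoint_left.1 (hDK B hB') ((mem_filter.1 hB).2 hx) hx

theorem disjoint_of_uniform {F G : Finset (Finset (Fin n))} (hF : F ⊆ powersetCard a univ)
    (hG : ∀ B ∈ G, #B = b) (hab : b < a) : Disjoint F G := by
  rw [disjoint_left]
  intro A hA hA'
  have h1 := (mem_powersetCard.1 (hF hA)).2
  have h2 := hG A hA'
  omega

theorem card_extremalFamily {D : Fin (t - 1) → Finset (Fin n)} (hb : 1 ≤ b) (ht : 1 ≤ t)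
    (ha : b + t ≤ a + 1) (hta : b < a) (hn : a + b ≤ n) (hs1 : 1 ≤ s) (hsb : s ≤ b)
    (hDc : ∀ i, #(D i) = b) (hDs : ∀ i, Disjoint (D i) (initSegment n s))
    (hD : ∀ i j, i ≠ j → Disjoint (D i) (D j)) :
    #(extremalFamily n a b s D) =
      meetCountWith b (t - 1) s n a + (n - s).choose (b - s) + (t - 1) := by
  have hinj : Function.Injective D := by
    intro i j hij
    by_contra hne
    have h1 := hD i j hne
    rw [hij, disjoint_self_iff_empty] at h1
    have h2 := hDc j
    rw [h1, card_empty] at h2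
    omega
  have hc : #(univ.image D) = t - 1 := by
    rw [card_image_of_injective _ hinj, card_univ, Fintype.card_fin]
  have hs : #(initSegment n s) = s := card_initSegment (by omega)
  have h1 : ∀ E ∈ univ.image D, #E = b := by simpa using hDc
  have h2 : ∀ E ∈ univ.image D, Disjoint E (initSegment n s) := by simpa using hDs
  have h3 : ((univ.image D : Finset (Finset (Fin n))) : Set (Finset (Fin n))).PairwiseDisjoint
      id := by
    intro X hX Y hY hXY
    obtain ⟨i, -, rfl⟩ := mem_image.1 hX
    obtain ⟨j, -, rfl⟩ := mem_image.1 hY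
    exact hD i j fun h => hXY (h ▸ rfl)
  rw [extremalFamily_eq D hsb hn, card_union_of_disjoint, card_extremalLeft (by omega) h1 h2 h3,
    card_extremalRight (by omega) (by omega) h2, hs, hc, add_assoc]
  refine disjoint_of_uniform (a := a) (b := b) (filter_subset _ _) (fun B hB => ?_) hta
  rcases mem_extremalRight.1 hB with hB | hB
  · exact hB.1
  · exact h1 B hB

theorem exists_perm_image_eq {K L : Finset (Fin n)} (h : #K = #L) :
    ∃ σ : Equiv.Perm (Fin n), K.image σ = L := by
  let e : {x // x ∈ K} ≃ {x // x ∈ L} := Finset.equivOfCardEq h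
  refine ⟨e.extendSubtype, eq_of_subset_of_card_le ?_ ?_⟩
  · intro y hy
    obtain ⟨x, hx, rfl⟩ := mem_image.1 hy
    exact e.extendSubtype_mem x hx
  · rw [card_image_of_injective _ (Equiv.injective _), h]

theorem card_image_perm (σ : Equiv.Perm (Fin n)) (M : Finset (Finset (Fin n))) :
    #(M.image fun A => A.image σ) = #M :=
  card_image_of_injective _ (image_injective σ.injective)

/-- Families inside an extremal configuration that attain the bound are extremal. -/
theorem exists_iso_of_subset {F G : Finset (Finset (Fin n))} {K : Finset (Fin n)}
    {𝒟 : Finset (Finset (Fin n))} (hb : 1 ≤ b) (ht : 1 ≤ t)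
    (ha : b + t ≤ a + 1) (hta : b < a) (hn : a + b ≤ n) (hs1 : 1 ≤ #K) (hsb : #K ≤ b)
    (hDc : ∀ D ∈ 𝒟, #D = b) (hDK : ∀ D ∈ 𝒟, Disjoint D K) (hDt : #𝒟 = t - 1)
    (hpd : (𝒟 : Set (Finset (Fin n))).PairwiseDisjoint id)
    (hF : F ⊆ extremalLeft a K 𝒟) (hG : G ⊆ extremalRight b K 𝒟)
    (hcard : meetCountWith b (t - 1) #K n a + (n - #K).choose (b - #K) + (t - 1) ≤ #(F ∪ G)) :
    ∃ M, IsExtremalFamily n a b #K t M ∧ FamilyIso (F ∪ G) M := by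
  obtain ⟨σ, hσ⟩ := exists_perm_image_eq (K := K) (L := initSegment n #K)
    (card_initSegment (by omega)).symm
  have hdis : ∀ X Y : Finset (Fin n), Disjoint X Y → Disjoint (X.image σ) (Y.image σ) :=
    fun X Y h => (disjoint_image σ.injective).2 h
  have hmeet : ∀ X Y : Finset (Fin n), (X ∩ Y).Nonempty → (X.image σ ∩ Y.image σ).Nonempty := by
    intro X Y h
    rw [← image_inter _ _ σ.injective]
    exact h.image σ
  let e : Fin (t - 1) ≃ {D // D ∈ 𝒟} := (𝒟.equivFinOfCardEq hDt).symm
  let D : Fin (t - 1) → Finset (Fin n) := fun i => (e i).1.image σ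
  have h1 : ∀ i, #(D i) = b := fun i => by
    rw [card_image_of_injective _ σ.injective]
    exact hDc _ (e i).2
  have h2 : ∀ i, Disjoint (D i) (initSegment n #K) := fun i => by
    rw [← hσ]
    exact hdis _ _ (hDK _ (e i).2)
  have h3 : ∀ i j, i ≠ j → Disjoint (D i) (D j) := fun i j hij =>
    hdis _ _ (hpd (e i).2 (e j).2 fun h => hij (e.injective (Subtype.ext h)))
  have himg : ∀ E ∈ 𝒟, E.image σ ∈ univ.image D := fun E hE =>
    mem_image.2 ⟨e.symm ⟨E, hE⟩, mem_univ _, by simp [D]⟩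
  refine ⟨extremalFamily n a b #K D, ⟨D, h1, h2, h3, rfl⟩, σ, eq_of_subset_of_card_le ?_ ?_⟩
  · rw [extremalFamily_eq D hsb hn]
    intro X hX
    obtain ⟨A, hA, rfl⟩ := mem_image.1 hX
    rw [mem_union]
    rcases mem_union.1 hA with hA | hA
    · left
      have hA := mem_extremalLeft.1 (hF hA)
      refine mem_extremalLeft.2 ⟨?_, ?_, fun E hE => ?_⟩
      · rw [card_image_of_injective _ σ.injective, hA.1]
      · rw [← hσ]
        exact hmeet _ _ hA.2.1
      · obtain ⟨i, -, rfl⟩ := mem_image.1 hE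
        exact hmeet _ _ (hA.2.2 _ (e i).2)
    · right
      refine mem_extremalRight.2 ((mem_extremalRight.1 (hG hA)).imp (fun hA => ⟨?_, ?_⟩) (himg A))
      · rw [card_image_of_injective _ σ.injective, hA.1]
      · rw [← hσ]
        exact image_subset_image hA.2
  · rw [card_image_perm, card_extremalFamily hb ht ha hta hn hs1 hsb h1 h2 h3]
    exact hcard

end CrossCover
namespace CrossCover
open Finset

/-! ### Structure forced by equality. -/

section TwoPoints
variable {α : Type*} [DecidableEq α]
variable {V : Finset α} {a b t : ℕ} {F H : Finset (Finset α)}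

/-- In the equality case, two points of the cover are contained in the same members of `H`. -/
theorem CrossSystem.two_points (S : CrossSystem V a b (t + 1) F H) (ht : 1 ≤ t)
    (ha : b + t ≤ a) (hu : ∀ B ∈ H, #B = b) (hn : a + b < #V) {C : Finset α} (hCV : C ⊆ V)
    (hCb : #C ≤ b) (hC : ∀ A ∈ F, (C ∩ A).Nonempty) (hirr : Irredundant F C)
    (heq : meetCountWith b t #C #V a + (#V - #C).choose (b - #C) + t ≤ #F + #H)
    {x y : α} (hx : x ∈ C) (hy : y ∈ C) (hxy : x ≠ y) :
    (∀ B ∈ H, x ∈ B → y ∈ B) ∧ #{B ∈ H | x ∉ B ∧ y ∉ B} ≤ t := by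
  have hs : H.slice b = H := filter_true_of_mem hu
  have hyx : y ∈ C.erase x := mem_erase.2 ⟨hxy.symm, hy⟩
  have hc1 : #(C.erase x) = #C - 1 := card_erase_of_mem hx
  have hc2 : #((C.erase x).erase y) = #(C.erase x) - 1 := card_erase_of_mem hyx
  have hc0 := Finset.card_pos.2 ⟨y, hyx⟩
  have hv1 : #(V.erase x) = #V - 1 := card_erase_of_mem (hCV hx)
  have hv2 : #((V.erase x).erase y) = #(V.erase x) - 1 :=
    card_erase_of_mem (mem_erase.2 ⟨hxy.symm, hCV hy⟩)
  obtain ⟨k, rfl⟩ := Nat.exists_eq_add_of_le' (show 2 ≤ b by omega)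
  obtain ⟨c, hc⟩ := Nat.exists_eq_add_of_le' (show 2 ≤ #C by omega)
  have hirr1 := hirr.erase hx
  have hFy := hirr1.memberSubfamily_nonempty hyx
  -- `F` is split into the sets through x, those avoiding x but containing y, and those avoiding
  -- both; `h1`, `h2`, `h3` bound the three parts.
  have SL := (S.trace x).link y
  have h1 := (S.link x).card_add_card_slice_le (by omega) (by omega)
    (hirr.memberSubfamily_nonempty hx) (j := k + 2) (by omega) le_rfl (by omega)
  have h2 := SL.card_add_card_slice_le (by omega) (by omega) hFy (j := k + 1) (by omega)
    (by omega) (by omega)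
  have h3 := ((S.trace x).trace y).card_add_card_slice_le_of_cover ht ha (j := k) (by omega)
    (by omega) (erase_subset_erase y (erase_subset_erase x hCV)) (by omega)
    (cover_erase (cover_erase hC)) (hirr1.erase hyx)
  have h4 := card_memberSubfamily_add_card_nonMemberSubfamily x F
  have h5 := card_memberSubfamily_add_card_nonMemberSubfamily y (F.nonMemberSubfamily x)
  have h6 := card_slice_eq H x (k + 2)
  have h7 := card_le_card (memberSubfamily_slice_subset H x (k + 1))
  have h8 := card_slice_eq (H.image (erase · x)) y (k + 1)
  have h9 := card_le_card (memberSubfamily_slice_subset (H.image (erase · x)) y k)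
  rw [hs] at h6
  rw [hc, meetCountWith_succ, meetCountWith_succ] at heq
  rw [if_pos rfl, hv1, Nat.add_sub_cancel] at h1
  rw [if_neg (by omega), hv2, hv1, Nat.add_sub_cancel] at h2
  rw [if_neg (by omega), hc2, hc1, hv2, hv1, show #C - 1 - 1 = c by omega,
    show #V - 1 - 1 - c = #V - (c + 2) by omega] at h3
  rw [show k + 2 - (c + 2) = k - c by omega] at heq
  rw [hs] at h7
  -- A member of `H` containing x but not y would land in this slice of size b - 1 and make the
  -- middle bound strict.
  have hempty : ((H.image (erase · x)).nonMemberSubfamily y).slice (k + 1) = ∅ := by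
    by_contra hne
    have := SL.card_add_card_slice_lt (by omega) hFy (j := k + 1) (by omega) (by omega) (by omega)
      (Or.inr (by omega)) (nonempty_iff_ne_empty.2 hne)
    rw [hv2, hv1, Nat.add_sub_cancel] at this
    omega
  refine ⟨fun B hB hxB => ?_, ?_⟩
  · by_contra hyB
    refine notMem_empty (B.erase x) ?_
    rw [← hempty, mem_slice, mem_nonMemberSubfamily, card_erase_of_mem hxB, hu B hB]
    exact ⟨⟨mem_image_of_mem _ hB, fun h => hyB (mem_of_mem_erase h)⟩, rfl⟩
  -- With the slice of size b - 1 empty, `F` alone attains the middle bound. The slice of size b of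
  -- the same system, containing all members that avoid x and y, is then left with at most t sets.
  · have h10 := SL.card_add_card_slice_le (by omega) (by omega) hFy (j := k + 2) (by omega)
      le_rfl (by omega)
    rw [if_pos rfl, hv2, hv1, Nat.add_sub_cancel] at h10
    rw [hempty, card_empty] at h2 h8
    have h11 : {B ∈ H | x ∉ B ∧ y ∉ B} ⊆
        ((H.image (erase · x)).nonMemberSubfamily y).slice (k + 2) := by
      intro B hB
      rw [mem_filter] at hB
      rw [mem_slice, mem_nonMemberSubfamily]
      exact ⟨⟨mem_image.2 ⟨B, hB.1, erase_eq_of_notMem hB.2.1⟩, hB.2.2⟩, hu B hB.1⟩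
    have h12 := card_le_card h11
    omega

/-- In the equality case with a cover `{x}`, only `t` members of `H` avoid `x`. -/
theorem CrossSystem.one_point (S : CrossSystem V a b (t + 1) F H) (ht : 1 ≤ t) (hb : 2 ≤ b)
    (ha : b + t ≤ a) (hu : ∀ B ∈ H, #B = b) (hn : a + b < #V) {x : α} (hx : x ∈ V)
    (hC : ∀ A ∈ F, x ∈ A) (hF : F.Nonempty)
    (hex : t = 1 → a = b + 1 → 3 ≤ b ∧ ∃ T : Finset α, #T = 2 ∧ ∀ B ∈ H, (T ∩ B).Nonempty)
    (heq : meetCountWith b t 1 #V a + (#V - 1).choose (b - 1) + t ≤ #F + #H) :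
    #(H.nonMemberSubfamily x) ≤ t := by
  have hs : H.slice b = H := filter_true_of_mem hu
  have hv : #(V.erase x) = #V - 1 := card_erase_of_mem hx
  have hvb : b - 1 + 2 ≤ #V - 1 := by omega
  have h1 : F.nonMemberSubfamily x = ∅ := by
    refine eq_empty_of_forall_notMem fun A hA => ?_
    rw [mem_nonMemberSubfamily] at hA
    exact hA.2 (hC A hA.1)
  have h2 := card_memberSubfamily_add_card_nonMemberSubfamily x F
  rw [h1, card_empty, add_zero] at h2
  have hFx : (F.memberSubfamily x).Nonempty := Finset.card_pos.1 (h2 ▸ Finset.card_pos.2 hF)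
  have h3 := card_memberSubfamily_add_card_nonMemberSubfamily x H
  have hsub : H.memberSubfamily x ⊆ powersetCard (b - 1) (V.erase x) := by
    intro B hB
    rw [mem_memberSubfamily] at hB
    rw [← mem_powersetCard_insert (by omega) hx hB.2, mem_powersetCard]
    exact ⟨(S.right _ hB.1).1, hu _ hB.1⟩
  have h4 := card_le_card hsub
  rw [card_powersetCard, hv] at h4
  have h5 := (S.link x).card_add_card_slice_le (by omega) (by omega) hFx (j := b) (by omega)
    le_rfl (by omega)
  rw [if_pos rfl, hv, Nat.add_sub_cancel, slice_nonMemberSubfamily, hs] at h5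
  rw [meetCountWith_succ, meetCountWith_zero, add_zero] at heq
  obtain ⟨t, rfl⟩ := Nat.exists_eq_add_of_le' ht
  refine (S.link x).card_le_of_eq (by omega) hb hFx
    (fun B hB => hu B (mem_nonMemberSubfamily.1 hB).1) (by omega) ?_ ?_
  · by_cases h : t = 0 ∧ a = b + 1
    · obtain ⟨rfl, rfl⟩ := h
      obtain ⟨hb3, T, hT, hTH⟩ := hex rfl rfl
      -- Equality forces `H` to contain every b-set through x, and one of these avoids any 2-set not
      -- containing x. So x lies in T, and the other point of T lies in every member avoiding x.
      have hxT : x ∈ T := by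
        by_contra hxT
        obtain ⟨B, hBs, hBc⟩ := exists_subset_card_eq (s := V.erase x \ T) (n := b - 1) (by
          have := le_card_sdiff T (V.erase x)
          rw [hv, hT] at this
          exact (Nat.le_sub_of_add_le hvb).trans this)
        rw [subset_sdiff] at hBs
        have hB : B ∈ H.memberSubfamily x := by
          rw [eq_of_subset_of_card_le hsub (by rw [card_powersetCard, hv]; omega)]
          exact mem_powersetCard.2 ⟨hBs.1, hBc⟩
        have h6 := hTH _ (mem_memberSubfamily.1 hB).1
        rw [inter_comm, insert_inter_nonempty hxT] at h6
        exact not_disjoint_iff_nonempty_inter.2 h6 hBs.2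
      obtain ⟨z, hz⟩ := card_eq_one.1 (show #(T.erase x) = 1 by rw [card_erase_of_mem hxT]; omega)
      refine Or.inr (Or.inr ⟨hb3, z, fun B hB => ?_⟩)
      rw [mem_nonMemberSubfamily] at hB
      obtain ⟨w, hw⟩ := hTH B hB.1
      rw [mem_inter] at hw
      have : w ∈ T.erase x := mem_erase.2 ⟨fun h => hB.2 (h ▸ hw.2), hw.1⟩
      rw [hz, mem_singleton] at this
      exact this ▸ hw.2
    · omega
  · rw [hv, ← meetCount_succ]
    omega

end TwoPoints

/-! ### Covering numbers and conclusion. -/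

variable {n a b s t : ℕ} {F G : Finset (Finset (Fin n))}

theorem exists_isCover_card_eq (h0 : ∀ A ∈ F, A.Nonempty) :
    ∃ C : Finset (Fin n), #C = coveringNumber F ∧ IsCover F C :=
  Nat.sInf_mem (s := {k | ∃ T : Finset (Fin n), #T = k ∧ IsCover F T})
    ⟨_, univ, rfl, fun A hA => by rw [univ_inter]; exact h0 A hA⟩

theorem not_isCover_of_card_lt {T : Finset (Fin n)} (h : #T < coveringNumber F) :
    ¬ IsCover F T := fun hT => Nat.notMem_of_lt_sInf h ⟨T, rfl, hT⟩

theorem irredundant_of_card_eq {C : Finset (Fin n)} (hC : IsCover F C)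
    (hc : #C = coveringNumber F) : Irredundant F C := by
  intro x hx
  have h := not_isCover_of_card_lt (hc ▸ card_erase_lt_of_mem hx)
  unfold IsCover at h
  push Not at h
  obtain ⟨A, hA, hAC⟩ := h
  refine ⟨A, hA, ?_⟩
  obtain ⟨y, hy⟩ := hC A hA
  have hAx : ∀ z ∈ C ∩ A, z = x := by
    intro z hz
    by_contra hne
    rw [mem_inter] at hz
    exact notMem_empty z (hAC ▸ mem_inter.2 ⟨mem_erase.2 ⟨hne, hz.1⟩, hz.2⟩)
  rw [inter_comm]
  exact eq_singleton_iff_unique_mem.2 ⟨hAx y hy ▸ hy, hAx⟩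

theorem crossSystem_of_coveringNumber (hF : F ⊆ powersetCard a univ)
    (hG : G ⊆ powersetCard b univ) (hFG : CrossIntersecting F G) (ht : t ≤ coveringNumber G) :
    CrossSystem univ a b t F G where
  left := hF
  right := fun B hB => ⟨subset_univ B, (mem_powersetCard.1 (hG hB)).2.le⟩
  cross := hFG
  hard := by
    intro T hT
    have h := not_isCover_of_card_lt (hT.trans_le ht)
    unfold IsCover at h
    push Not at h
    obtain ⟨B, hB, hTB⟩ := h
    exact ⟨B, hB, disjoint_iff_inter_eq_empty.2 hTB⟩

/-- Once the members of `G` either contain or avoid the cover `C`, and at most `t` avoid it, the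
configuration is extremal. -/
theorem exists_iso_of_structure (S : CrossSystem univ a b (t + 1) F G)
    (hb : 2 ≤ b) (ha : b + t ≤ a) (hn : a + b ≤ n) (hta : b < a) (hF : F.Nonempty)
    (hu : ∀ B ∈ G, #B = b)
    {C : Finset (Fin n)} (hCb : #C ≤ b) (hC : IsCover F C)
    (heq : meetCountWith b t #C n a + (n - #C).choose (b - #C) + t ≤ #F + #G)
    {x : Fin n} (hx : x ∈ C) (h1 : ∀ B ∈ G, x ∈ B → C ⊆ B) (h2 : ∀ B ∈ G, x ∉ B → Disjoint B C)
    (h3 : #(G.nonMemberSubfamily x) ≤ t) :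
    ∃ M, IsExtremalFamily n a b #C (t + 1) M ∧ FamilyIso (F ∪ G) M := by
  have SL := S.link x
  have h0 : ∀ B ∈ G.nonMemberSubfamily x, B.Nonempty := fun B hB =>
    Finset.card_pos.1 (S.card_pos hF (mem_nonMemberSubfamily.1 hB).1)
  have h4 := le_card_of_hard h0 SL.hard
  -- The link needs t points to be covered, so at most t members means exactly t, pairwise disjoint.
  have h5 := pairwiseDisjoint_of_hard h0 SL.hard (by omega)
  refine exists_iso_of_subset (𝒟 := G.nonMemberSubfamily x) (by omega) (by omega) (by omega) hta
    hn (Finset.card_pos.2 ⟨x, hx⟩) hCb ?_ ?_ (by omega) h5 ?_ ?_ ?_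
  · exact fun B hB => hu B (mem_nonMemberSubfamily.1 hB).1
  · intro B hB
    rw [mem_nonMemberSubfamily] at hB
    exact h2 B hB.1 hB.2
  · intro A hA
    refine mem_extremalLeft.2 ⟨(mem_powersetCard.1 (S.left hA)).2, ?_, fun B hB => ?_⟩
    · rw [inter_comm]; exact hC A hA
    · exact S.cross A hA B (mem_nonMemberSubfamily.1 hB).1
  · intro B hB
    rw [mem_extremalRight, mem_nonMemberSubfamily]
    by_cases hxB : x ∈ B
    · exact Or.inl ⟨hu B hB, h1 B hB hxB⟩
    · exact Or.inr ⟨hB, hxB⟩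
  · rwa [card_union_of_disjoint (disjoint_of_uniform S.left hu hta), Nat.add_sub_cancel]

end CrossCover

open CrossCover in
theorem mainTheorem2 (n a b s t : ℕ) (F G : Finset (Finset (Fin n)))
    (hF : F ⊆ Finset.powersetCard a Finset.univ)
    (hG : G ⊆ Finset.powersetCard b Finset.univ)
    (hFG : CrossIntersecting F G)
    (ht : 2 ≤ t) (hb : 2 ≤ b) (ha : b + t - 1 ≤ a) (hn : max (a + b) (b * t) ≤ n)
    (hs : coveringNumber F = s)
    (hτ : t ≤ coveringNumber G ∨ coveringNumber G = t) :
    (F.card : ℤ) + (G.card : ℤ) ≤ crossBound n a b s t ∧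
    (a + b < n → 1 ≤ s →
      ((∃ M, IsExtremalFamily n a b s t M ∧ FamilyIso (F ∪ G) M) →
        (F.card : ℤ) + (G.card : ℤ) = crossBound n a b s t) ∧
      (¬ (s = 1 ∧ t = 2 ∧ a = b + 1 ∧ (b = 2 ∨ 2 < coveringNumber G)) →
        (F.card : ℤ) + (G.card : ℤ) = crossBound n a b s t →
        ∃ M, IsExtremalFamily n a b s t M ∧ FamilyIso (F ∪ G) M)) := by
  have hτ' : t ≤ coveringNumber G := hτ.elim id fun h => h.ge
  have hnab : a + b ≤ n := (le_max_left _ _).trans hn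
  have hnbt : b * t ≤ n := (le_max_right _ _).trans hn
  have hu : ∀ B ∈ G, B.card = b := fun B hB => (Finset.mem_powersetCard.1 (hG hB)).2
  have hGne : ∀ B ∈ G, B.Nonempty := fun B hB => Finset.card_pos.1 (by rw [hu B hB]; omega)
  have hFne : ∀ A ∈ F, A.Nonempty := fun A hA =>
    Finset.card_pos.1 (by rw [(Finset.mem_powersetCard.1 (hF hA)).2]; omega)
  obtain ⟨C, hCs, hC⟩ := exists_isCover_card_eq hFne
  have hirr := irredundant_of_card_eq hC hCs
  have S := crossSystem_of_coveringNumber hF hG hFG hτ'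
  -- Every member of `G` is itself a cover of `F`.
  have hsb : s ≤ b := by
    obtain ⟨B, hB, -⟩ := S.hard ∅ (by rw [Finset.card_empty]; omega)
    by_contra! h
    refine not_isCover_of_card_lt (F := F) (T := B) (by rw [hu B hB]; omega) fun A hA => ?_
    rw [Finset.inter_comm]
    exact hFG A hA B hB
  rw [crossBound_eq (by omega) (by omega) hnbt hsb]
  -- From here on t is the number of disjoint sets, one less than in the statement.
  obtain ⟨t, rfl⟩ := Nat.exists_eq_add_of_le' (show 1 ≤ t by omega)
  rw [Nat.add_sub_cancel]
  have hslice : G.slice b = G := Finset.filter_true_of_mem hu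
  rw [hs] at hCs
  have hcard : (Finset.univ : Finset (Fin n)).card = n := by simp
  constructor
  · have h := S.card_add_card_slice_le_of_cover (by omega) (by omega) le_rfl (by omega)
      (Finset.subset_univ C) (by omega) hC hirr
    rw [if_pos rfl, hslice, hcard, hCs] at h
    exact_mod_cast h
  intro hlt hs1
  have hdis := disjoint_of_uniform hF hu (show b < a by omega)
  constructor
  · rintro ⟨M, ⟨D, h1, h2, h3, rfl⟩, σ, hσ⟩
    have h4 := card_image_perm σ (F ∪ G)
    rw [hσ, card_extremalFamily (by omega) (by omega) (by omega) (by omega) hnab hs1 hsb h1 h2 h3,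
      Finset.card_union_of_disjoint hdis, Nat.add_sub_cancel] at h4
    exact_mod_cast h4.symm
  · intro hex heq
    have heq' : F.card + G.card = meetCountWith b t s n a + (n - s).choose (b - s) + t := by
      exact_mod_cast heq
    rw [← hCs] at heq' ⊢
    obtain ⟨x, hx⟩ : C.Nonempty := Finset.card_pos.1 (by omega)
    have hF0 : F.Nonempty := by
      obtain ⟨A, hA, -⟩ := hirr x hx
      exact ⟨A, hA⟩
    rcases hs1.eq_or_lt with rfl | hs2
    · obtain ⟨y, rfl⟩ := Finset.card_eq_one.1 hCs
      obtain rfl := Finset.mem_singleton.1 hx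
      refine exists_iso_of_structure S hb (by omega) hnab (by omega) hF0 hu (by omega) hC heq'.ge
        hx (fun B _ h => Finset.singleton_subset_iff.2 h)
        (fun B _ h => Finset.disjoint_singleton_right.2 h) ?_
      refine S.one_point (by omega) hb (by omega) hu (by omega) (Finset.mem_univ x) ?_ hF0 ?_ ?_
      · intro A hA
        obtain ⟨w, hw⟩ := hC A hA
        rw [Finset.mem_inter, Finset.mem_singleton] at hw
        exact hw.1 ▸ hw.2
      · intro ht1 hab
        -- The excluded case leaves only b ≥ 3 with a 2-point cover of `G`, which supplies the set T
        -- for `CrossSystem.one_point`.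
        have h2 : coveringNumber G = 2 := by omega
        obtain ⟨T, hT, hTG⟩ := exists_isCover_card_eq hGne
        exact ⟨by omega, T, by omega, hTG⟩
      · rw [hcard]
        rw [Finset.card_singleton] at heq'
        exact heq'.ge
    · have htwo : ∀ x ∈ C, ∀ y ∈ C, x ≠ y → _ := fun x hx y hy hxy =>
        S.two_points (by omega) (by omega) hu (by omega) (Finset.subset_univ C) (by omega) hC hirr
          (by rw [hcard]; exact heq'.ge) hx hy hxy
      have hiff : ∀ x ∈ C, ∀ y ∈ C, ∀ B ∈ G, x ∈ B → y ∈ B := by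
        intro x hx y hy B hB hxB
        by_cases hxy : x = y
        · exact hxy ▸ hxB
        · exact (htwo x hx y hy hxy).1 B hB hxB
      refine exists_iso_of_structure S hb (by omega) hnab (by omega) hF0 hu (by omega) hC heq'.ge
        hx (fun B hB hxB y hy => hiff x hx y hy B hB hxB) (fun B hB hxB => ?_) ?_
      · rw [Finset.disjoint_right]
        exact fun y hy hyB => hxB (hiff y hy x hx B hB hyB)
      · obtain ⟨y, hy, hyx⟩ := Finset.exists_mem_ne (show 1 < C.card by omega) x
        refine (Finset.card_le_card fun B hB => ?_).trans (htwo x hx y hy hyx.symm).2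
        rw [Finset.mem_nonMemberSubfamily] at hB
        exact Finset.mem_filter.2 ⟨hB.1, hB.2, fun hyB => hB.2 (hiff y hy x hx B hB.1 hyB)⟩
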